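/- Let $L$ be a positive definite even lattice (free abelian of finite rank) with form $\langle\cdot,\cdot\rangle$, and let $1\to\langle\pm1\rangle\to\hat L\xrightarrow{\,\bar{\ }\,}L\to 1$ be a central extension with commutator map $c(\alpha,\beta)=(-1)^{\langle\alpha,\beta\rangle}$. Put $\mathfrak h=\mathbb C\otimes_{\mathbb Z}L$ and let $V_L=M(1)\otimes\mathbb C\{L\}$ be the lattice vertex operator algebra, where $M(1)=S(\mathfrak h\otimes t^{-1}\mathbb C[t^{-1}])$ is the Heisenberg Fock space of level one, $\mathbb C\{L\}=\mathbb C[\hat L]\otimes_{\langle\pm1\rangle}\mathbb C$ (with $-1$ acting on $\mathbb C$ as $-1$), and $\iota(a)=1\otimes(a\otimes 1)$ for $a\in\hat L$. The vertex operators are the standard ones, determined by $Y(h(-1)\mathbf 1,z)=\sum_{n\in\mathbb Z}h(n)z^{-n-1}$ for $h\in\mathfrak h$ and $$Y(\iota(a),z)=\exp\Bigl(\sum_{n>0}\tfrac{\bar a(-n)}{n}z^{n}\Bigr)\exp\Bigl(-\sum_{n>0}\tfrac{\bar a(n)}{n}z^{-n}\Bigr)a\,z^{\bar a}\qquad(a\in\hat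 L),$$ and the Virasoro element is $\omega=\frac12\sum_i h_i(-1)^2\mathbf 1$ for an orthonormal basis $(h_i)$ of $\mathfrak h$; a vector $v$ has weight $n$ if $L(0)v=nv$, where $Y(\omega,z)=\sum_n L(n)z^{-n-2}$. Let $\theta$ be an automorphism of $\hat L$ with $\theta^2=1$ which induces $-1$ on $L$ (for example $\theta(a)=a^{-1}(-1)^{\langle\bar a,\bar a\rangle/2}$), and denote also by $\theta$ the induced automorphism of $V_L$, $h_1(-n_1)\cdots h_k(-n_k)\otimes\iota(a)\mapsto(-1)^k h_1(-n_1)\cdots h_k(-n_k)\otimes\iota(\theta a)$. Let $O_\theta(V_L)$ be the linear span of the vectors $$u\circ_\theta v=\operatorname{Res}_z\frac{(1+z)^{\operatorname{wt}u}}{z^{2}}Y(u,z)v\quad(\theta u=u),\qquad u\circ_\theta v=\operatorname{Res}_z\frac{(1+z)^{\operatorname{wt}u-\frac12}}{z}Y(u,z)v\quad(\theta u=-u),$$ where $u\in V_L$ is homogeneous, $v\in V_L$, and powers of $1+z$ are expanded in nonnegative powers of $z$; put $A_\theta(V_L)=V_L/O_\theta(V_L)$. Let $\alpha\mapsto e_\alpha$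 be any section $L\to\hat L$ and let $(\beta_i)_{i\in L/2L}$ be a system of representatives of the cosets of $2L$ in $L$. Then $A_\theta(V_L)$ is spanned by the classes $\iota(e_{\beta_i})+O_\theta(V_L)$, $i\in L/2L$. In particular $\dim A_\theta(V_L)\le|L/2L|$. -/

import Mathlib

open scoped TensorProduct

noncomputable section

/-! ### The twisted Zhu space of a vertex operator algebra -/

namespace TwistedZhu

variable {V : Type*} [AddCommGroup V] [Module ℂ V]

/-- `Res_z (1 + z)^s z^(-k) f(z)` for `f ∈ V((z))`, with `(1 + z)^s` expanded in nonnegative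
powers of `z`. -/
def residue (s : ℂ) (k : ℤ) (f : HahnModule ℤ ℂ V) : V :=
  ((HahnModule.of ℂ).symm
    ((HahnSeries.single (-k) (1 : ℂ) *
      HahnSeries.ofPowerSeries ℤ ℂ (PowerSeries.binomialSeries ℂ s)) • f)).coeff (-1)

/-- The weight space `V_n = {v | L(0) v = n v}`, where `L(0) = ω_1` is the coefficient of
`z^(-2)` in `Y(ω, z)`. -/
def weightSpace (Y : V →ₗ[ℂ] VertexOperator ℂ V) (ω : V) (n : ℤ) : Submodule ℂ V :=
  Module.End.eigenspace (VertexOperator.ncoeff (Y ω) 1) (n : ℂ)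

/-- The eigenspace `V^r = {v | g v = exp(-2πir/T) v}`. -/
def sector (g : V →ₗ[ℂ] V) (T r : ℕ) : Submodule ℂ V :=
  Module.End.eigenspace g (Complex.exp (-2 * Real.pi * Complex.I * r / T))

/-- `δ_r`, equal to `1` if `r = 0` and to `0` otherwise. -/
def delta (r : ℕ) : ℕ := if r = 0 then 1 else 0

/-- `u ∘_g v` for `u ∈ V^r` homogeneous of weight `n`. -/
def circ (Y : V →ₗ[ℂ] VertexOperator ℂ V) (T r : ℕ) (n : ℤ) (u v : V) : V :=
  residue ((n : ℂ) - 1 + delta r + (r : ℂ) / T) (1 + delta r) (Y u v)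

/-- `O_g(V)`, the linear span of all `u ∘_g v` with `u ∈ V^r` homogeneous, `0 ≤ r < T`,
and `v ∈ V`. -/
def O (Y : V →ₗ[ℂ] VertexOperator ℂ V) (ω : V) (g : V →ₗ[ℂ] V) (T : ℕ) : Submodule ℂ V :=
  Submodule.span ℂ {w | ∃ (r : ℕ) (n : ℤ) (u v : V), r < T ∧ u ∈ sector g T r ∧
    u ∈ weightSpace Y ω n ∧ w = circ Y T r n u v}

/-- `A_g(V) = V / O_g(V)`. -/
abbrev A (Y : V →ₗ[ℂ] VertexOperator ℂ V) (ω : V) (g : V →ₗ[ℂ] V) (T : ℕ) : Type _ :=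
  V ⧸ O Y ω g T

end TwistedZhu

/-- The action of `S((z))` on `V((z))` for an `S`-module `V`, `S` a commutative `ℂ`-algebra. -/
def seriesAction (S V : Type*) [CommRing S] [Algebra ℂ S] [AddCommGroup V] [Module ℂ V]
    [Module S V] [IsScalarTower ℂ S V] :
    HahnSeries ℤ S →+* Module.End ℂ (HahnModule ℤ ℂ V) where
  toFun f :=
    { toFun := fun x => HahnModule.of ℂ ((HahnModule.of S).symm
        (f • HahnModule.of S ((HahnModule.of ℂ).symm x)))
      map_add' := fun x y => by simp
      map_smul' := fun c x => by
        have h1 : HahnModule.of S ((HahnModule.of ℂ).symm (c • x)) =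
            algebraMap ℂ S c • HahnModule.of S ((HahnModule.of ℂ).symm x) := by
          refine HahnModule.ext _ _ (funext fun n => ?_)
          exact (algebraMap_smul S c (((HahnModule.of ℂ).symm x).coeff n)).symm
        have h2 : ∀ y : HahnModule ℤ S V,
            HahnModule.of ℂ ((HahnModule.of S).symm (algebraMap ℂ S c • y)) =
              c • HahnModule.of ℂ ((HahnModule.of S).symm y) := by
          intro y
          refine HahnModule.ext _ _ (funext fun n => ?_)
          exact algebraMap_smul S c (((HahnModule.of S).symm y).coeff n)
        rw [h1, ← smul_comm (algebraMap ℂ S c) f, h2, RingHom.id_apply] }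
  map_one' := by apply LinearMap.ext; intro x; simp
  map_mul' f g := by apply LinearMap.ext; intro x; simp [mul_smul]
  map_zero' := by apply LinearMap.ext; intro x; simp
  map_add' f g := by apply LinearMap.ext; intro x; simp [add_smul]

/-- The inclusion of `V` into `V((z))` as constant series. -/
def constSeries (V : Type*) [AddCommGroup V] [Module ℂ V] : V →ₗ[ℂ] HahnModule ℤ ℂ V where
  toFun v := HahnModule.of ℂ (HahnSeries.single 0 v)
  map_add' v w := by rw [HahnSeries.single_add, HahnModule.of_add]
  map_smul' c v := congrArg (HahnModule.of ℂ) (map_smul (HahnSeries.single.linearMap (0 : ℤ)) c v)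

theorem seriesAction_C (S V : Type*) [CommRing S] [Algebra ℂ S] [AddCommGroup V] [Module ℂ V]
    [Module S V] [IsScalarTower ℂ S V] (c : ℂ) :
    seriesAction S V (HahnSeries.C (algebraMap ℂ S c)) = c • 1 := by
  apply LinearMap.ext
  intro x
  refine HahnModule.ext _ _ (funext fun n => ?_)
  change ((HahnModule.of S).symm (HahnSeries.single (0 : ℤ) (algebraMap ℂ S c) •
    HahnModule.of S ((HahnModule.of ℂ).symm x))).coeff n = c • ((HahnModule.of ℂ).symm x).coeff n
  rw [HahnModule.coeff_single_zero_smul, algebraMap_smul, Equiv.symm_apply_apply]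

/-! ### Even lattices and their central extensions -/

/-- A positive definite even form on `L`; an even lattice is a free abelian group of finite rank
with such a form. -/
structure EvenLattice (L : Type*) [AddCommGroup L] where
  form : LinearMap.BilinForm ℤ L
  symm : ∀ x y, form x y = form y x
  even : ∀ x, Even (form x x)
  pos : ∀ x, x ≠ 0 → 0 < form x x

/-- A central extension `1 → ⟨±1⟩ → G → L → 1` with commutator map
`c(α, β) = (-1)^⟨α, β⟩`; the nontrivial element of the kernel is `neg`. -/
structure CentralExtension {L : Type*} [AddCommGroup L] (Λ : EvenLattice L)
    (G : Type*) [Group G] where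
  proj : G →* Multiplicative L
  surj : Function.Surjective proj
  neg : G
  neg_ne_one : neg ≠ 1
  neg_central : ∀ a, neg * a = a * neg
  ker : ∀ a, proj a = 1 ↔ a = 1 ∨ a = neg
  comm : ∀ a b, a * b * a⁻¹ * b⁻¹ = neg ^ Λ.form (proj a).toAdd (proj b).toAdd

namespace LatticeVOA

/-- `𝔥 = ℂ ⊗ L`. -/
abbrev Cartan (L : Type*) [AddCommGroup L] : Type _ := ℂ ⊗[ℤ] L

/-- `M(1) = S(𝔥 ⊗ t⁻¹ℂ[t⁻¹])`, where `Finsupp.single n h` stands for `h(-n-1) = h ⊗ t^(-n-1)`. -/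
def Fock (L : Type*) [AddCommGroup L] : Type _ := SymmetricAlgebra ℂ (ℕ →₀ Cartan L)

namespace Fock

variable {L : Type*} [AddCommGroup L]

instance : CommRing (Fock L) := inferInstanceAs (CommRing (SymmetricAlgebra ℂ (ℕ →₀ Cartan L)))

instance : Algebra ℂ (Fock L) :=
  inferInstanceAs (Algebra ℂ (SymmetricAlgebra ℂ (ℕ →₀ Cartan L)))

/-- The inclusion of `𝔥 ⊗ t⁻¹ℂ[t⁻¹]` into `M(1)`. -/
def gen : (ℕ →₀ Cartan L) →ₗ[ℂ] Fock L := SymmetricAlgebra.ι ℂ (ℕ →₀ Cartan L)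

/-- The algebra map out of `M(1)` into a possibly noncommutative algebra determined
by a linear map with pairwise commuting values. -/
def lift {A : Type*} [Semiring A] [Algebra ℂ A] (f : (ℕ →₀ Cartan L) →ₗ[ℂ] A)
    (hf : ∀ x y, f x * f y = f y * f x) : Fock L →ₐ[ℂ] A :=
  (RingCon.liftₐ _ (TensorAlgebra.lift ℂ f) (RingCon.ringConGen_le.2 (by
    rintro _ _ ⟨x, y⟩
    simpa [RingCon.ker_apply] using hf x y)) : SymmetricAlgebra ℂ (ℕ →₀ Cartan L) →ₐ[ℂ] A)

theorem lift_gen {A : Type*} [Semiring A] [Algebra ℂ A] (f : (ℕ →₀ Cartan L) →ₗ[ℂ] A)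
    (hf : ∀ x y, f x * f y = f y * f x) (x : ℕ →₀ Cartan L) : lift f hf (gen x) = f x :=
  TensorAlgebra.lift_ι_apply f x

theorem induction {motive : Fock L → Prop}
    (algebraMap : ∀ r, motive (algebraMap ℂ (Fock L) r)) (gen : ∀ x, motive (gen x))
    (mul : ∀ a b, motive a → motive b → motive (a * b))
    (add : ∀ a b, motive a → motive b → motive (a + b)) (a : Fock L) : motive a :=
  SymmetricAlgebra.induction ℂ (ℕ →₀ Cartan L) algebraMap gen mul add a

end Fock

section Heisenberg

variable {L : Type*} [AddCommGroup L] (Λ : EvenLattice L)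

/-- The `ℂ`-bilinear extension of the form to `𝔥`. -/
def cform : LinearMap.BilinForm ℂ (Cartan L) := Λ.form.baseChange ℂ

theorem exists_orthonormalBasis [Module.Free ℤ L] [Module.Finite ℤ L] :
    ∃ b : Module.Basis (Fin (Module.finrank ℂ (Cartan L))) ℂ (Cartan L),
      ∀ i j, cform Λ (b i) (b j) = if i = j then 1 else 0 := by
  have hnd : (cform Λ).SeparatingLeft := by
    let b := Module.Free.chooseBasis ℤ L
    have h1 : Λ.form.SeparatingLeft := by
      intro x hx
      by_contra h
      exact (Λ.pos x h).ne' (hx x)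
    have h2 := (LinearMap.separatingLeft_iff_det_ne_zero b).1 h1
    apply LinearMap.separatingLeft_of_det_ne_zero (b.baseChange ℂ)
    have h3 : LinearMap.toMatrix₂ (b.baseChange ℂ) (b.baseChange ℂ) (cform Λ) =
        (LinearMap.toMatrix₂ b b Λ.form).map (algebraMap ℤ ℂ) := by
      ext i j
      simp [LinearMap.toMatrix₂_apply, cform]
    rw [h3, ← RingHom.mapMatrix_apply, ← RingHom.map_det]
    simpa using h2
  have : Invertible (2 : ℂ) := invertibleOfNonzero two_ne_zero
  obtain ⟨v, hv⟩ := LinearMap.BilinForm.exists_orthogonal_basis (B := cform Λ)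
    (LinearMap.BilinForm.IsSymm.baseChange ℂ ⟨Λ.symm⟩)
  have hv0 := hv.not_isOrtho_basis_self_of_separatingLeft hnd
  choose c hc using fun i =>
    IsAlgClosed.exists_pow_nat_eq (cform Λ (v i) (v i)) (n := 2) (by norm_num)
  have hc0 : ∀ i, c i ≠ 0 := fun i h => hv0 i (by
    change cform Λ (v i) (v i) = 0
    rw [← hc i, h]; simp)
  refine ⟨v.isUnitSMul (w := fun i => (c i)⁻¹) (fun i => (inv_ne_zero (hc0 i)).isUnit),
    fun i j => ?_⟩
  simp only [Module.Basis.isUnitSMul_apply, map_smul, LinearMap.smul_apply, smul_eq_mul]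
  split_ifs with h
  · subst h
    rw [← hc i]; field_simp [hc0 i]
  · have : cform Λ (v i) (v j) = 0 := hv h
    simp [this]

/-- An orthonormal basis of `𝔥`. -/
def orthonormalBasis [Module.Free ℤ L] [Module.Finite ℤ L] :
    Module.Basis (Fin (Module.finrank ℂ (Cartan L))) ℂ (Cartan L) :=
  (exists_orthonormalBasis Λ).choose

/-- The element `h(-n-1)` of `M(1)`. -/
def creation (n : ℕ) : Cartan L →ₗ[ℂ] Fock L :=
  Fock.gen ∘ₗ Finsupp.lsingle n

/-- The linear map `𝔥 ⊗ t⁻¹ℂ[t⁻¹] → ⨁_{j ≥ 0} M(1)` sending `h(-m)` to the family whose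
entry at `j = m` is `m ⟨α, h⟩` and whose other entries are `0`. -/
def contract (α : Cartan L) : (ℕ →₀ Cartan L) →ₗ[ℂ] (ℕ →₀ Fock L) :=
  Finsupp.lsum ℂ fun m =>
    Finsupp.lsingle (m + 1) ∘ₗ Algebra.linearMap ℂ (Fock L) ∘ₗ (((m : ℂ) + 1) • cform Λ α)

/-- The derivation `Q ↦ (α(j) Q)_j` of `M(1)`, `j > 0` (the entry at `j = 0` is `0`); it is the
unique derivation of `S(𝔥 ⊗ t⁻¹ℂ[t⁻¹])` extending `contract`, obtained through the
square zero extension. -/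
def annihilationFock (α : Cartan L) : Fock L →ₗ[ℂ] (ℕ →₀ Fock L) :=
  (TrivSqZeroExt.sndHom (Fock L) (ℕ →₀ Fock L)).restrictScalars ℂ ∘ₗ
    (Fock.lift
      ((TrivSqZeroExt.inlAlgHom ℂ (Fock L) (ℕ →₀ Fock L)).toLinearMap ∘ₗ Fock.gen +
        (TrivSqZeroExt.inrHom (Fock L) (ℕ →₀ Fock L)).restrictScalars ℂ ∘ₗ
          contract Λ α) (fun _ _ => mul_comm _ _)).toLinearMap


theorem annihilationFock_gen (α : Cartan L) (x : ℕ →₀ Cartan L) :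
    annihilationFock Λ α (Fock.gen x) = contract Λ α x := by
  simp [annihilationFock, Fock.lift_gen]

theorem annihilationFock_algebraMap (α : Cartan L) (c : ℂ) :
    annihilationFock Λ α (algebraMap ℂ (Fock L) c) = 0 := by
  simp [annihilationFock, TrivSqZeroExt.algebraMap_eq_inl']

theorem annihilationFock_mul (α : Cartan L) (P Q : Fock L) :
    annihilationFock Λ α (P * Q) =
      P • annihilationFock Λ α Q + Q • annihilationFock Λ α P := by
  have h : ∀ R : Fock L, (Fock.lift
      ((TrivSqZeroExt.inlAlgHom ℂ (Fock L) (ℕ →₀ Fock L)).toLinearMap ∘ₗ Fock.gen +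
        (TrivSqZeroExt.inrHom (Fock L) (ℕ →₀ Fock L)).restrictScalars ℂ ∘ₗ
          contract Λ α) (fun _ _ => mul_comm _ _) R).fst = R := by
    intro R
    induction R using Fock.induction with
    | algebraMap r => simp [TrivSqZeroExt.algebraMap_eq_inl']
    | gen x => simp [Fock.lift_gen]
    | mul a b ha hb => simp [ha, hb]
    | add a b ha hb => simp [ha, hb]
  simp [annihilationFock, h]

theorem annihilationFock_comm (α β : Cartan L) (i j : ℕ) (Q : Fock L) :
    annihilationFock Λ α (annihilationFock Λ β Q j) i =
      annihilationFock Λ β (annihilationFock Λ α Q i) j := by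
  have hc : ∀ (γ : Cartan L) (k : ℕ) (x : ℕ →₀ Cartan L),
      ∃ c : ℂ, contract Λ γ x k = algebraMap ℂ (Fock L) c := by
    intro γ k x
    induction x using Finsupp.induction_linear with
    | zero => exact ⟨0, by simp⟩
    | add x y hx hy =>
      obtain ⟨c, hc⟩ := hx
      obtain ⟨d, hd⟩ := hy
      exact ⟨c + d, by simp [hc, hd]⟩
    | single n h =>
      by_cases hk : n + 1 = k
      · exact ⟨((n : ℂ) + 1) * cform Λ γ h, by simp [contract, hk]⟩
      · exact ⟨0, by simp [contract, hk]⟩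
  induction Q using Fock.induction with
  | algebraMap r => simp [annihilationFock_algebraMap]
  | gen x =>
    obtain ⟨c, h1⟩ := hc β j x
    obtain ⟨d, h2⟩ := hc α i x
    simp [annihilationFock_gen, h1, h2, annihilationFock_algebraMap]
  | mul a b ha hb =>
    simp [annihilationFock_mul, ha, hb]
    ring
  | add a b ha hb => simp [ha, hb]

theorem annihilationFock_add (α β : Cartan L) :
    annihilationFock Λ (α + β) = annihilationFock Λ α + annihilationFock Λ β := by
  have hc : ∀ x, contract Λ (α + β) x = contract Λ α x + contract Λ β x := by
    intro x
    induction x using Finsupp.induction_linear with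
    | zero => simp
    | add x y hx hy => rw [map_add, hx, hy, map_add, map_add]; abel
    | single n h => simp [contract]
  ext1 Q
  induction Q using Fock.induction with
  | algebraMap r => simp [annihilationFock_algebraMap]
  | gen x => simp [annihilationFock_gen, hc]
  | mul a b ha hb =>
    rw [LinearMap.add_apply] at *
    simp only [annihilationFock_mul, ha, hb, smul_add]
    abel
  | add a b ha hb => rw [map_add, map_add, ha, hb]

theorem annihilationFock_smul (c : ℂ) (α : Cartan L) :
    annihilationFock Λ (c • α) = c • annihilationFock Λ α := by
  have hc : ∀ x, contract Λ (c • α) x = c • contract Λ α x := by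
    intro x
    induction x using Finsupp.induction_linear with
    | zero => simp
    | add x y hx hy => rw [map_add, hx, hy, map_add, smul_add]
    | single n h =>
      simp only [contract, Finsupp.coe_lsum, LinearMap.comp_apply, map_zero, Finsupp.sum_single_index,
        LinearMap.smul_apply, map_smul, smul_comm c]
  ext1 Q
  induction Q using Fock.induction with
  | algebraMap r => simp [annihilationFock_algebraMap]
  | gen x => simp [annihilationFock_gen, hc]
  | mul a b ha hb =>
    rw [LinearMap.smul_apply] at *
    simp only [annihilationFock_mul, ha, hb, smul_add]
    rw [smul_comm c a, smul_comm c b]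
  | add a b ha hb => rw [map_add, map_add, ha, hb]

end Heisenberg

section Space

variable {L : Type*} [AddCommGroup L] {Λ : EvenLattice L} {G : Type*} [Group G]
  (E : CentralExtension Λ G)

/-- The image `ā ∈ L` of `a ∈ G`. -/
def bar (a : G) : L := (E.proj a).toAdd

/-- The relations `(-1) a = - a` in the group algebra of `G`. -/
def signRelations : Submodule ℂ (G →₀ ℂ) :=
  Submodule.span ℂ (Set.range fun a : G => Finsupp.single (E.neg * a) 1 + Finsupp.single a 1)

/-- `ℂ{L} = ℂ[G] ⊗_{⟨±1⟩} ℂ`, where `-1` acts on `ℂ` as `-1`. -/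
abbrev TwistedGroupAlgebra : Type _ := (G →₀ ℂ) ⧸ signRelations E

/-- The element `a ⊗ 1` of `ℂ{L}`. -/
def tw (a : G) : TwistedGroupAlgebra E := (signRelations E).mkQ (Finsupp.single a 1)

theorem tw_neg (a : G) : tw E (E.neg * a) = - tw E a := by
  rw [eq_neg_iff_add_eq_zero, tw, tw, ← map_add, Submodule.mkQ_apply,
    Submodule.Quotient.mk_eq_zero]
  exact Submodule.subset_span ⟨a, rfl⟩

/-- The linear map on `ℂ{L}` with prescribed values on the elements `a ⊗ 1`. -/
def twLift {M : Type*} [AddCommGroup M] [Module ℂ M] (f : G → M)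
    (hf : ∀ a, f (E.neg * a) = - f a) : TwistedGroupAlgebra E →ₗ[ℂ] M :=
  (signRelations E).liftQ (Finsupp.linearCombination ℂ f) (by
    rw [signRelations, Submodule.span_le]
    rintro _ ⟨a, rfl⟩
    simp [hf])

theorem twLift_tw {M : Type*} [AddCommGroup M] [Module ℂ M] (f : G → M)
    (hf : ∀ a, f (E.neg * a) = - f a) (a : G) : twLift E f hf (tw E a) = f a := by
  simp [twLift, tw]

theorem bar_neg_mul (a : G) : bar E (E.neg * a) = bar E a := by
  have h : E.proj E.neg = 1 := (E.ker _).2 (Or.inr rfl)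
  simp [bar, h]

/-- `V_L = M(1) ⊗ ℂ{L}`. -/
abbrev VL : Type _ := Fock L ⊗[ℂ] TwistedGroupAlgebra E

/-- `ι(a) = 1 ⊗ (a ⊗ 1) ∈ V_L`. -/
def iota (a : G) : VL E := 1 ⊗ₜ tw E a

/-- The action of `h(0)` on `ℂ{L}`: `h · ι(a) = ⟨h, ā⟩ ι(a)`. -/
def zeroMode (h : Cartan L) : TwistedGroupAlgebra E →ₗ[ℂ] TwistedGroupAlgebra E :=
  twLift E (fun a => cform Λ h (1 ⊗ₜ bar E a) • tw E a)
    (fun a => by rw [bar_neg_mul, tw_neg, smul_neg])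

theorem tw_ext {M : Type*} [AddCommGroup M] [Module ℂ M] {f g : TwistedGroupAlgebra E →ₗ[ℂ] M}
    (h : ∀ a, f (tw E a) = g (tw E a)) : f = g := by
  apply Submodule.linearMap_qext
  ext a
  simpa [tw] using h a

/-- The family `(h(j) v)_{j ≥ 0}`, where `h(0)` acts on the factor `ℂ{L}` and `h(j)`, `j > 0`,
acts on the factor `M(1)`. -/
def annihilation : Cartan L →ₗ[ℂ] VL E →ₗ[ℂ] (ℕ →₀ VL E) where
  toFun h :=
    (TensorProduct.finsuppLeft ℂ ℂ (Fock L) (TwistedGroupAlgebra E) ℕ).toLinearMap ∘ₗ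
        (annihilationFock Λ h).rTensor (TwistedGroupAlgebra E) +
      Finsupp.lsingle 0 ∘ₗ (zeroMode E h).lTensor (Fock L)
  map_add' α β := by
    have h : zeroMode E (α + β) = zeroMode E α + zeroMode E β :=
      tw_ext E fun a => by simp [zeroMode, twLift_tw, add_smul]
    rw [annihilationFock_add, h, LinearMap.rTensor_add, LinearMap.lTensor_add, LinearMap.comp_add,
      LinearMap.comp_add]
    abel
  map_smul' c α := by
    have h : zeroMode E (c • α) = c • zeroMode E α :=
      tw_ext E fun a => by simp [zeroMode, twLift_tw, mul_smul]
    rw [annihilationFock_smul, h, LinearMap.rTensor_smul, LinearMap.lTensor_smul,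
      LinearMap.comp_smul, LinearMap.comp_smul, RingHom.id_apply, smul_add]

theorem annihilation_tmul (h : Cartan L) (P : Fock L) (a : G) (j : ℕ) :
    annihilation E h (P ⊗ₜ tw E a) j = annihilationFock Λ h P j ⊗ₜ tw E a +
      (if j = 0 then cform Λ h (1 ⊗ₜ bar E a) else 0) • (P ⊗ₜ tw E a) := by
  by_cases hj : j = 0
  · subst hj
    simp [annihilation, zeroMode, twLift_tw]
  · simp [annihilation, hj]

theorem VL_ext {M : Type*} [AddCommGroup M] [Module ℂ M] {f g : VL E →ₗ[ℂ] M}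
    (h : ∀ P a, f (P ⊗ₜ tw E a) = g (P ⊗ₜ tw E a)) : f = g := by
  apply TensorProduct.ext
  ext1 P
  exact tw_ext E fun a => h P a

theorem annihilation_comm (α β : Cartan L) (i j : ℕ) (v : VL E) :
    annihilation E α (annihilation E β v j) i = annihilation E β (annihilation E α v i) j := by
  have h : Finsupp.lapply i ∘ₗ annihilation E α ∘ₗ Finsupp.lapply j ∘ₗ annihilation E β =
      Finsupp.lapply j ∘ₗ annihilation E β ∘ₗ Finsupp.lapply i ∘ₗ annihilation E α := by
    apply VL_ext
    intro P a
    simp only [LinearMap.comp_apply, Finsupp.lapply_apply, annihilation_tmul, map_add, map_smul,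
      annihilationFock_comm Λ α β i j, smul_add,
      smul_comm (if i = 0 then _ else _) (if j = 0 then _ else (0 : ℂ))]
    abel
  exact LinearMap.congr_fun h v

/-! ### Vertex operators -/

/-- The creation part of `∂^n h(z) / n!`: for `h(-n-1)` it is
`∑_{j ≥ 0} binom(n+j, n) h(-n-j-1) z^j`. -/
def creationSeries (x : ℕ →₀ Cartan L) : HahnSeries ℤ (Fock L) :=
  HahnSeries.ofPowerSeries ℤ (Fock L) (PowerSeries.mk fun j =>
    Finsupp.lsum ℂ (fun n => ((n + j).choose n : ℂ) • creation (n + j)) x)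

theorem creationSeries_add (x y : ℕ →₀ Cartan L) :
    creationSeries (x + y) = creationSeries x + creationSeries y := by
  rw [creationSeries, creationSeries, creationSeries, ← map_add]
  congr 1
  apply PowerSeries.ext
  intro j
  simp only [PowerSeries.coeff_mk, map_add]

theorem creationSeries_smul (c : ℂ) (x : ℕ →₀ Cartan L) :
    creationSeries (c • x) = HahnSeries.C (algebraMap ℂ (Fock L) c) * creationSeries x := by
  rw [creationSeries, creationSeries, ← HahnSeries.ofPowerSeries_C, ← map_mul]
  congr 1
  apply PowerSeries.ext
  intro j
  simp only [PowerSeries.coeff_mk, map_smul, PowerSeries.coeff_C_mul, Algebra.smul_def]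

/-- The part of `∂^n h(z) / n!` with the modes `h(j)`, `j ≥ 0`, applied to `v`: for `h(-n-1)` it
is the Laurent polynomial `∑_{j ≥ 0} (-1)^n binom(n+j, n) h(j) v z^(-n-1-j)`. -/
def annihilationSeries : (ℕ →₀ Cartan L) →ₗ[ℂ] VL E →ₗ[ℂ] (ℤ →₀ VL E) :=
  Finsupp.lsum ℂ fun n =>
    LinearMap.compRight ℂ (Finsupp.lsum ℂ fun j : ℕ =>
      ((-1) ^ n * ((n + j).choose n : ℂ)) • Finsupp.lsingle (-(n : ℤ) - 1 - j)) ∘ₗ annihilation E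

/-- The extension of `X(z) : V_L → V_L((z))` to Laurent polynomials:
`∑ w_k z^k ↦ ∑ z^k X(z) w_k`. -/
def extend : VertexOperator ℂ (VL E) →ₗ[ℂ] ((ℤ →₀ VL E) →ₗ[ℂ] HahnModule ℤ ℂ (VL E)) where
  toFun X := Finsupp.lsum ℂ fun k : ℤ =>
    seriesAction (Fock L) (VL E) (HahnSeries.single k 1) ∘ₗ X
  map_add' X Z := by
    apply Finsupp.lhom_ext
    intro k v
    simp
  map_smul' c X := by
    apply Finsupp.lhom_ext
    intro k v
    simp only [Finsupp.lsum_single, LinearMap.comp_apply, LinearMap.smul_apply, map_smul,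
      RingHom.id_apply]

theorem extend_single (X : VertexOperator ℂ (VL E)) (k : ℤ) (v : VL E) :
    extend E X (Finsupp.single k v) =
      seriesAction (Fock L) (VL E) (HahnSeries.single k 1) (X v) := by
  simp [extend]

/-- The normal ordered product of `∂^n h(z) / n!` with `X(z)`, for `h(-n-1)`: creation
operators are placed to the left of `X(z)`, the modes `h(j)`, `j ≥ 0`, to the right. -/
def normalOrder : (ℕ →₀ Cartan L) →ₗ[ℂ] Module.End ℂ (VertexOperator ℂ (VL E)) where
  toFun x :=
    LinearMap.compRight ℂ (seriesAction (Fock L) (VL E) (creationSeries x)) +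
      LinearMap.lcomp ℂ _ (annihilationSeries E x) ∘ₗ extend E
  map_add' x y := by
    apply LinearMap.ext; intro X; apply LinearMap.ext; intro v
    simp [creationSeries_add]
    abel
  map_smul' c x := by
    apply LinearMap.ext; intro X; apply LinearMap.ext; intro v
    rw [creationSeries_smul, map_mul, seriesAction_C, map_smul]
    simp only [LinearMap.add_apply, LinearMap.comp_apply, LinearMap.compRight_apply,
      LinearMap.lcomp_apply, LinearMap.smul_apply, Module.End.mul_apply, Module.End.one_apply,
      map_smul, RingHom.id_apply, smul_add]

theorem normalOrder_apply (x : ℕ →₀ Cartan L) (X : VertexOperator ℂ (VL E)) (v : VL E) :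
    normalOrder E x X v = seriesAction (Fock L) (VL E) (creationSeries x) (X v) +
      extend E X (annihilationSeries E x v) := rfl

theorem annihilationSeries_single (n N : ℕ) (α : Cartan L) (v : VL E)
    (hN : ∀ j, N ≤ j → annihilation E α v j = 0) :
    annihilationSeries E (Finsupp.single n α) v = ∑ j ∈ Finset.range N,
      ((-1) ^ n * ((n + j).choose n : ℂ)) •
        Finsupp.single (-(n : ℤ) - 1 - j) (annihilation E α v j) := by
  have h : annihilationSeries E (Finsupp.single n α) v = (annihilation E α v).sum fun j w =>
      ((-1) ^ n * ((n + j).choose n : ℂ)) • Finsupp.single (-(n : ℤ) - 1 - j) w := by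
    rw [annihilationSeries, Finsupp.lsum_single]
    rfl
  rw [h, Finsupp.sum_of_support_subset]
  · intro j hj
    rw [Finset.mem_range]
    by_contra hc
    exact Finsupp.mem_support_iff.1 hj (hN j (not_lt.1 hc))
  · simp

theorem normalOrder_single (m N : ℕ) (β : Cartan L) (X : VertexOperator ℂ (VL E)) (w : VL E)
    (hN : ∀ j, N ≤ j → annihilation E β w j = 0) :
    normalOrder E (Finsupp.single m β) X w =
      seriesAction (Fock L) (VL E) (creationSeries (Finsupp.single m β)) (X w) +
        ∑ j ∈ Finset.range N, ((-1) ^ m * ((m + j).choose m : ℂ)) •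
          seriesAction (Fock L) (VL E) (HahnSeries.single (-(m : ℤ) - 1 - j) 1)
            (X (annihilation E β w j)) := by
  rw [normalOrder_apply, annihilationSeries_single E m N β w hN]
  simp only [map_sum, map_smul, extend_single]

theorem normalOrder_comm_aux {V W R : Type*} [AddCommGroup W] [Module ℂ W] [CommRing R]
    (ρ : R →+* Module.End ℂ W) (X : V → W) (N : ℕ) (c d : R) (y z : ℕ → R) (k l : ℕ → ℂ)
    (v : V) (a b : ℕ → V) (ab ba : ℕ → ℕ → V) (h : ∀ i j, ab i j = ba j i) :
    ρ c (ρ d (X v) + ∑ j ∈ Finset.range N, l j • ρ (z j) (X (b j))) +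
        ∑ i ∈ Finset.range N, k i • ρ (y i)
          (ρ d (X (a i)) + ∑ j ∈ Finset.range N, l j • ρ (z j) (X (ab i j))) =
      ρ d (ρ c (X v) + ∑ i ∈ Finset.range N, k i • ρ (y i) (X (a i))) +
        ∑ j ∈ Finset.range N, l j • ρ (z j)
          (ρ c (X (b j)) + ∑ i ∈ Finset.range N, k i • ρ (y i) (X (ba j i))) := by
  have hc : ∀ (f g : R) (w : W), ρ f (ρ g w) = ρ (f * g) w := fun f g w => by
    rw [map_mul, Module.End.mul_apply]
  simp only [map_add, map_sum, map_smul, smul_add, Finset.sum_add_distrib, Finset.smul_sum,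
    smul_smul, hc, h]
  rw [Finset.sum_comm (s := Finset.range N) (t := Finset.range N)
    (f := fun i j => (k i * l j) • ρ (y i * z j) (X (ba j i)))]
  simp only [mul_comm]
  abel

theorem normalOrder_comm (x y : ℕ →₀ Cartan L) :
    normalOrder E x * normalOrder E y = normalOrder E y * normalOrder E x := by
  induction x using Finsupp.induction_linear with
  | zero => simp
  | add x x2 h1 h2 => rw [map_add, add_mul, mul_add, h1, h2]
  | single n α =>
    induction y using Finsupp.induction_linear with
    | zero => simp
    | add y y2 h1 h2 => rw [map_add, mul_add, add_mul, h1, h2]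
    | single m β =>
      apply LinearMap.ext; intro X; apply LinearMap.ext; intro v
      obtain ⟨N, hN⟩ : ∃ N, (annihilation E α v).support ∪ (annihilation E β v).support ⊆
          Finset.range N := Finset.exists_nat_subset_range _
      have hα : ∀ j, N ≤ j → annihilation E α v j = 0 := fun j hj => by
        by_contra hc
        have := hN (Finset.mem_union_left _ (Finsupp.mem_support_iff.2 hc))
        exact absurd (Finset.mem_range.1 this) (not_lt.2 hj)
      have hβ : ∀ j, N ≤ j → annihilation E β v j = 0 := fun j hj => by
        by_contra hc
        have := hN (Finset.mem_union_right _ (Finsupp.mem_support_iff.2 hc))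
        exact absurd (Finset.mem_range.1 this) (not_lt.2 hj)
      have hβα : ∀ i j, N ≤ j → annihilation E β (annihilation E α v i) j = 0 := fun i j hj => by
        rw [← annihilation_comm, hβ j hj, map_zero, Finsupp.zero_apply]
      have hαβ : ∀ i j, N ≤ j → annihilation E α (annihilation E β v i) j = 0 := fun i j hj => by
        rw [← annihilation_comm, hα j hj, map_zero, Finsupp.zero_apply]
      rw [Module.End.mul_apply, Module.End.mul_apply, normalOrder_single E n N α _ v hα,
        normalOrder_single E m N β _ v hβ, normalOrder_single E m N β _ v hβ,
        normalOrder_single E n N α _ v hα]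
      simp only [normalOrder_single E m N β _ _ (hβα _), normalOrder_single E n N α _ _ (hαβ _)]
      exact normalOrder_comm_aux (seriesAction (Fock L) (VL E)) X N _ _ _ _ _ _ v _ _ _ _
        (fun i j => annihilation_comm E β α j i v)

/-- `exp(∑_{n > 0} ā(-n) z^n / n)`. -/
def expCreation (a : G) : HahnSeries ℤ (Fock L) :=
  HahnSeries.ofPowerSeries ℤ (Fock L) ((PowerSeries.exp ℂ).subst
    (PowerSeries.mk fun n =>
      if n = 0 then 0 else (n : ℂ)⁻¹ • creation (n - 1) (1 ⊗ₜ bar E a) : PowerSeries (Fock L)))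

/-- The operator `exp(-∑_{n > 0} ā(n) z^(-n) / n) : M(1) → M(1)[z⁻¹]`, with `z⁻¹` the polynomial
variable. The exponent is a derivation which maps `h(-m)` to `-⟨ā, h⟩ z^(-m)`, so its exponential
is the algebra map with `h(-m) ↦ h(-m) - ⟨ā, h⟩ z^(-m)`. -/
def expAnnihilation (a : G) : Fock L →ₐ[ℂ] Polynomial (Fock L) :=
  Fock.lift
    (Finsupp.lsum ℂ fun m =>
      (Polynomial.CAlgHom : Fock L →ₐ[ℂ] Polynomial (Fock L)).toLinearMap ∘ₗ creation m -
        LinearMap.toSpanSingleton ℂ (Polynomial (Fock L)) (Polynomial.X ^ (m + 1)) ∘ₗ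
          cform Λ (1 ⊗ₜ bar E a))
    (fun _ _ => mul_comm _ _)

/-- Substitution of `z⁻¹` for the polynomial variable. -/
def polynomialToSeries : Polynomial (Fock L) →+* HahnSeries ℤ (Fock L) :=
  Polynomial.eval₂RingHom HahnSeries.C (HahnSeries.single (-1) 1)

/-- The vertex operator `Y(ι(a), z)`:
`Q ⊗ ι(b) ↦ z^⟨ā, b̄⟩ exp(∑_{n > 0} ā(-n) z^n / n) exp(-∑_{n > 0} ā(n) z^(-n) / n) Q ⊗ ι(ab)`. -/
def vertexIota (a : G) : VertexOperator ℂ (VL E) :=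
  TensorProduct.lift (LinearMap.flip (twLift E
    (fun b =>
      { toFun := fun Q => seriesAction (Fock L) (VL E)
          (HahnSeries.single (Λ.form (bar E a) (bar E b)) 1 * expCreation E a *
            polynomialToSeries (expAnnihilation E a Q))
          (constSeries (VL E) (iota E (a * b)))
        map_add' := fun P Q => by simp only [map_add, mul_add, LinearMap.add_apply]
        map_smul' := fun c Q => by
          have h : polynomialToSeries (expAnnihilation E a (c • Q)) =
              HahnSeries.C (algebraMap ℂ (Fock L) c) *
                polynomialToSeries (expAnnihilation E a Q) := by
            rw [map_smul, Algebra.smul_def, map_mul, Polynomial.algebraMap_apply]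
            simp [polynomialToSeries]
          rw [h, mul_left_comm, map_mul, seriesAction_C]
          rfl })
    (fun b => by
      apply LinearMap.ext
      intro Q
      have h : iota E (a * (E.neg * b)) = - iota E (a * b) := by
        rw [← mul_assoc, ← E.neg_central, mul_assoc, iota, tw_neg, TensorProduct.tmul_neg, iota]
      simp only [LinearMap.coe_mk, AddHom.coe_mk, LinearMap.neg_apply, bar_neg_mul, h,
        map_neg])))

theorem vertexIota_tmul (a b : G) (Q : Fock L) :
    vertexIota E a (Q ⊗ₜ tw E b) = seriesAction (Fock L) (VL E)
      (HahnSeries.single (Λ.form (bar E a) (bar E b)) 1 * expCreation E a *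
        polynomialToSeries (expAnnihilation E a Q))
      (constSeries (VL E) (iota E (a * b))) := by
  simp [vertexIota, twLift_tw]

/-- `Y(·, z)` on the subspace `ℂ{L}` of `V_L`. -/
def vertexTw : TwistedGroupAlgebra E →ₗ[ℂ] VertexOperator ℂ (VL E) :=
  twLift E (vertexIota E) (fun a => by
    apply VL_ext
    intro Q b
    have h : iota E (E.neg * a * b) = - iota E (a * b) := by
      rw [mul_assoc, iota, tw_neg, TensorProduct.tmul_neg, iota]
    rw [LinearMap.neg_apply, vertexIota_tmul, vertexIota_tmul, h, map_neg, map_neg, bar_neg_mul]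
    simp only [expCreation, expAnnihilation, bar_neg_mul])

/-- The iterated normal ordered product: `h_1(-n_1) ⋯ h_k(-n_k) ∈ M(1)` maps `X(z)` to the normal
ordered product of `∂^(n_i - 1) h_i(z) / (n_i - 1)!`, `1 ≤ i ≤ k`, and `X(z)`. -/
def normalOrderFock : Fock L →ₐ[ℂ] Module.End ℂ (VertexOperator ℂ (VL E)) :=
  Fock.lift (normalOrder E) (normalOrder_comm E)

/-- The vertex operator map of `V_L`: `Y(h_1(-n_1) ⋯ h_k(-n_k) ⊗ ι(a), z)` is the normal ordered
product of `∂^(n_i - 1) h_i(z) / (n_i - 1)!`, `1 ≤ i ≤ k`, and `Y(ι(a), z)`. -/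
def Y : VL E →ₗ[ℂ] VertexOperator ℂ (VL E) :=
  TensorProduct.lift (LinearMap.mk₂ ℂ (fun P c => normalOrderFock E P (vertexTw E c))
    (fun P Q c => by rw [map_add, LinearMap.add_apply])
    (fun r P c => by rw [map_smul, LinearMap.smul_apply])
    (fun P c d => by rw [map_add, map_add])
    (fun r P c => by rw [map_smul, map_smul]))

/-- The Virasoro element `ω = (1/2) ∑ h_i(-1)^2 1`, `(h_i)` an orthonormal basis of `𝔥`. -/
def omega [Module.Free ℤ L] [Module.Finite ℤ L] : VL E :=
  (1 / 2 : ℂ) • ∑ i, (creation 0 (orthonormalBasis Λ i) ^ 2) ⊗ₜ tw E 1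

/-- The automorphism of `V_L` induced by an automorphism `θ` of `G` which lifts `-1`:
`h_1(-n_1) ⋯ h_k(-n_k) ⊗ ι(a) ↦ (-h_1)(-n_1) ⋯ (-h_k)(-n_k) ⊗ ι(θ a)`. -/
def thetaMap (θ : G ≃* G) (hθ : ∀ a, bar E (θ a) = - bar E a) : VL E →ₗ[ℂ] VL E :=
  TensorProduct.map
    (Fock.lift (-Fock.gen) (fun _ _ => mul_comm _ _) : Fock L →ₐ[ℂ] Fock L).toLinearMap
    (twLift E (fun a => tw E (θ a)) (fun a => by
      have h1 : E.proj E.neg = 1 := (E.ker _).2 (Or.inr rfl)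
      have h2 : E.proj (θ E.neg) = 1 := by
        have h3 := hθ E.neg
        rw [bar, bar, h1] at h3
        exact Multiplicative.toAdd.injective (by simpa using h3)
      have h4 : θ E.neg = E.neg := by
        rcases (E.ker _).1 h2 with h | h
        · exact absurd (θ.injective (h.trans (map_one θ).symm)) E.neg_ne_one
        · exact h
      rw [map_mul, h4, tw_neg]))

end Space

end LatticeVOA

end

/-!
For `θu = -u` and `p ≥ 1` the residues of `(1 + z)^(wt u - 1/2) z^(-p) Y(u, z) v` all lie in
`O_θ(V_L)`: integration by parts raises the order of the pole. For `u = h(-1)1` they express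
`h(-n) v` through the vectors `h(i) v` with `i ≥ 0` and through `h(-m) v` with `m < n`, so that
`V_L` is spanned modulo `O_θ(V_L)` by the vectors `ι(a)`.

Let `ℓ` be a functional vanishing on `O_θ(V_L)` and let `S_k` be the Schur polynomials in the
`ā(-n)`. The same relations say that `g(z) = ∑_k ℓ(S_k ⊗ ι(ab)) z^k` solves a linear differential
equation of order one, whose solutions are the multiples of an explicit product of powers of
`1 + z` and of `(1 + (1 + z)^(1/2)) / 2`. For `u = ι(a) - ι(θa)` and `⟨ā, b̄⟩ = m ≥ 0` the residue
at `p = m + 1` compares the coefficients of `z^0` and of `z^(2m)` in two such products, and yields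
`ι(ab) ≡ 16^(-m) ι(θ(a)b)`. The elements `ab` and `θ(a)b` of the extension have images in `L` which
differ by `2ā`, so the class of `ι(a)` depends, up to a scalar, only on the coset of `ā` modulo
`2L`.
-/

noncomputable section

namespace TwistedZhu

/-! ### Laurent series -/

/-- The coefficient of `z ^ n` in a Laurent series with coefficients in `V`. -/
def laurentCoeff {V : Type*} [AddCommGroup V] [Module ℂ V] (n : ℤ) :
    HahnModule ℤ ℂ V →ₗ[ℂ] V where
  toFun f := ((HahnModule.of ℂ).symm f).coeff n
  map_add' _ _ := rfl
  map_smul' _ _ := rfl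

/-- The Euler operator `z d/dz` on `W((z))`. -/
def euler {W : Type*} [AddCommGroup W] : HahnSeries ℤ W →+ HahnSeries ℤ W where
  toFun f :=
    { coeff := fun n => n • f.coeff n
      isPWO_support' := f.isPWO_support.mono fun n hn h0 => hn (by simp [h0]) }
  map_zero' := by ext n; exact smul_zero n
  map_add' f g := by ext n; exact smul_add n (f.coeff n) (g.coeff n)

/-- The Euler operator `z d/dz` on `V((z))` as a module over `ℂ((z))`. -/
def moduleEuler {V : Type*} [AddCommGroup V] [Module ℂ V] :
    HahnModule ℤ ℂ V →+ HahnModule ℤ ℂ V where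
  toFun x := HahnModule.of ℂ (euler ((HahnModule.of ℂ).symm x))
  map_zero' := congrArg (HahnModule.of ℂ) (map_zero euler)
  map_add' _ _ := congrArg (HahnModule.of ℂ) (map_add euler _ _)

/-- `X'(z)` is the formal derivative `d/dz X(z)`; both sides are multiplied by `z`. -/
def IsDeriv {V : Type*} [AddCommGroup V] [Module ℂ V] (X X' : VertexOperator ℂ V) : Prop :=
  ∀ v, moduleEuler (X v) = seriesAction ℂ V (HahnSeries.single 1 1) (X' v)

section Euler

theorem coeff_euler {W : Type*} [AddCommGroup W] (f : HahnSeries ℤ W) (n : ℤ) :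
    (euler f).coeff n = n • f.coeff n := rfl

theorem support_euler_subset {W : Type*} [AddCommGroup W] (f : HahnSeries ℤ W) :
    (euler f).support ⊆ f.support :=
  fun n hn h => hn (by rw [coeff_euler, h, smul_zero])

theorem euler_smul {R W : Type*} [CommRing R] [AddCommGroup W] [Module R W]
    (f : HahnSeries ℤ R) (x : HahnModule ℤ R W) :
    euler ((HahnModule.of R).symm (f • x)) =
      (HahnModule.of R).symm (euler f • x) +
        (HahnModule.of R).symm (f • HahnModule.of R (euler ((HahnModule.of R).symm x))) := by
  ext n
  rw [coeff_euler, HahnSeries.coeff_add, HahnModule.coeff_smul,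
    HahnModule.coeff_smul_left f.isPWO_support (support_euler_subset f),
    HahnModule.coeff_smul_right ((HahnModule.of R).symm x).isPWO_support
      (support_euler_subset _), ← Finset.sum_add_distrib, Finset.smul_sum]
  refine Finset.sum_congr rfl fun ⟨i, j⟩ hij => ?_
  obtain ⟨-, -, rfl⟩ := (Finset.mem_vaddAntidiagonal _ _).1 hij
  simp only [vadd_eq_add, coeff_euler, Equiv.symm_apply_apply, add_smul, smul_assoc,
    smul_comm (f.coeff i) j]

theorem euler_mul {R : Type*} [CommRing R] (f g : HahnSeries ℤ R) :
    euler (f * g) = euler f * g + f * euler g := by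
  simpa only [← HahnSeries.of_symm_smul_of_eq_mul, Equiv.symm_apply_apply] using
    euler_smul f (HahnModule.of R g)

theorem euler_single {R : Type*} [CommRing R] (k : ℤ) (r : R) :
    euler (HahnSeries.single k r) = (k : HahnSeries ℤ R) * HahnSeries.single k r := by
  ext n
  rw [coeff_euler, ← zsmul_eq_mul, HahnSeries.coeff_smul]
  obtain rfl | hn := eq_or_ne n k
  · rfl
  · simp only [HahnSeries.coeff_single_of_ne hn, smul_zero]

theorem euler_ofPowerSeries {R : Type*} [CommRing R] (φ : PowerSeries R) :
    euler (HahnSeries.ofPowerSeries ℤ R φ) =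
      HahnSeries.ofPowerSeries ℤ R (PowerSeries.X * PowerSeries.derivative R φ) := by
  ext n
  rw [coeff_euler, PowerSeries.coeff_coe, PowerSeries.coeff_coe]
  split_ifs with hn
  · exact smul_zero n
  · lift n to ℕ using not_lt.1 hn
    cases n with
    | zero => simp
    | succ n =>
      rw [Int.natAbs_natCast, PowerSeries.coeff_succ_X_mul, PowerSeries.coeff_derivative,
        zsmul_eq_mul, mul_comm]
      push_cast
      rfl

end Euler

section Module

variable {V : Type*} [AddCommGroup V] [Module ℂ V]

theorem laurentCoeff_ext {f g : HahnModule ℤ ℂ V}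
    (h : ∀ n, laurentCoeff n f = laurentCoeff n g) : f = g :=
  HahnModule.ext f g (funext h)

theorem laurentCoeff_moduleEuler (n : ℤ) (f : HahnModule ℤ ℂ V) :
    laurentCoeff n (moduleEuler f) = n • laurentCoeff n f := rfl

variable {S : Type*} [CommRing S] [Algebra ℂ S] [Module S V] [IsScalarTower ℂ S V]

theorem moduleEuler_smul (c : ℂ) (f : HahnModule ℤ ℂ V) :
    moduleEuler (c • f) = c • moduleEuler f :=
  laurentCoeff_ext fun n => by
    simp only [laurentCoeff_moduleEuler, map_smul, smul_comm c n]

theorem moduleEuler_seriesAction (f : HahnSeries ℤ S) (x : HahnModule ℤ ℂ V) :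
    moduleEuler (seriesAction S V f x) =
      seriesAction S V (euler f) x + seriesAction S V f (moduleEuler x) :=
  congrArg (HahnModule.of ℂ) (euler_smul f (HahnModule.of S ((HahnModule.of ℂ).symm x)))

theorem moduleEuler_constSeries (v : V) : moduleEuler (constSeries V v) = 0 :=
  laurentCoeff_ext fun n => by
    rw [laurentCoeff_moduleEuler]
    change n • (HahnSeries.single 0 v).coeff n = 0
    rw [HahnSeries.coeff_single]
    split_ifs with h
    · rw [h, zero_smul]
    · exact smul_zero n

theorem coeff_ofPowerSeries_smul {R W : Type*} [CommRing R] [AddCommGroup W] [Module R W]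
    (φ : PowerSeries R) (x : HahnModule ℤ R W) (n : ℤ) (N : ℕ)
    (hN : ∀ j : ℕ, N ≤ j → ((HahnModule.of R).symm x).coeff (n - j) = 0) :
    ((HahnModule.of R).symm (HahnSeries.ofPowerSeries ℤ R φ • x)).coeff n =
      ∑ j ∈ Finset.range N, PowerSeries.coeff j φ • ((HahnModule.of R).symm x).coeff (n - j) := by
  have hpos : ∀ i : ℤ, (HahnSeries.ofPowerSeries ℤ R φ).coeff i ≠ 0 → 0 ≤ i := fun i hi => by
    by_contra hc
    exact hi (by rw [PowerSeries.coeff_coe, if_pos (not_le.1 hc)])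
  rw [HahnModule.coeff_smul]
  apply Finset.sum_of_injOn (fun ij => ij.1.toNat)
  · rintro ⟨i, j⟩ hij ⟨i', j'⟩ hij' h
    obtain ⟨hi, -, hadd⟩ := (Finset.mem_vaddAntidiagonal _ _).1 hij
    obtain ⟨hi', -, hadd'⟩ := (Finset.mem_vaddAntidiagonal _ _).1 hij'
    have := hpos i hi
    have := hpos i' hi'
    simp only [vadd_eq_add] at hadd hadd' h
    ext <;> dsimp only <;> omega
  · rintro ⟨i, j⟩ hij
    obtain ⟨hi, hj, hadd⟩ := (Finset.mem_vaddAntidiagonal _ _).1 hij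
    lift i to ℕ using hpos i hi
    obtain rfl : j = n - i := by simp only [vadd_eq_add] at hadd; omega
    exact Finset.mem_coe.2 (Finset.mem_range.2 (not_le.1 fun h => hj (hN i h)))
  · intro i _ hi
    by_contra hne
    refine hi ⟨(i, n - i), (Finset.mem_vaddAntidiagonal _ _).2 ⟨?_, ?_, by simp⟩,
      Int.toNat_natCast i⟩
    · rw [HahnSeries.mem_support, HahnSeries.ofPowerSeries_apply_coeff]
      exact left_ne_zero_of_smul hne
    · exact right_ne_zero_of_smul hne
  · rintro ⟨i, j⟩ hij
    obtain ⟨hi, -, rfl⟩ := (Finset.mem_vaddAntidiagonal _ _).1 hij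
    lift i to ℕ using hpos i hi
    simp [HahnSeries.ofPowerSeries_apply_coeff]

theorem laurentCoeff_seriesAction_ofPowerSeries (φ : PowerSeries S) (x : HahnModule ℤ ℂ V)
    (n : ℤ) (N : ℕ) (hN : ∀ j : ℕ, N ≤ j → laurentCoeff (n - j) x = 0) :
    laurentCoeff n (seriesAction S V (HahnSeries.ofPowerSeries ℤ S φ) x) =
      ∑ j ∈ Finset.range N, PowerSeries.coeff j φ • laurentCoeff (n - j) x :=
  coeff_ofPowerSeries_smul φ (HahnModule.of S ((HahnModule.of ℂ).symm x)) n N hN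

theorem laurentCoeff_seriesAction_single (k : ℤ) (x : HahnModule ℤ ℂ V) (n : ℤ) :
    laurentCoeff n (seriesAction S V (HahnSeries.single k 1) x) = laurentCoeff (n - k) x := by
  have h := HahnModule.coeff_single_smul_vadd (r := (1 : S)) (b := k) (a := n - k)
    (x := HahnModule.of S ((HahnModule.of ℂ).symm x))
  rw [vadd_eq_add, add_sub_cancel, one_smul] at h
  exact h

theorem seriesAction_single_algebraMap (k : ℤ) :
    seriesAction S V (HahnSeries.single k 1) = seriesAction ℂ V (HahnSeries.single k 1) :=
  LinearMap.ext fun x => laurentCoeff_ext fun n => by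
    rw [laurentCoeff_seriesAction_single, laurentCoeff_seriesAction_single]

theorem seriesAction_C_mul (c : ℂ) (f : HahnSeries ℤ S) (x : HahnModule ℤ ℂ V) :
    seriesAction S V (HahnSeries.C (algebraMap ℂ S c) * f) x = c • seriesAction S V f x := by
  rw [map_mul, seriesAction_C]
  rfl

theorem laurentCoeff_seriesAction_constSeries (f : HahnSeries ℤ S) (w : V) (n : ℤ) :
    laurentCoeff n (seriesAction S V f (constSeries V w)) = f.coeff n • w := by
  change ((HahnModule.of S).symm (f • HahnModule.of S (HahnSeries.single (0 : ℤ) w))).coeff n = _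
  rw [HahnModule.coeff_smul_right (s := {0}) (Set.isPWO_singleton _)
    (by simpa using HahnSeries.support_single_subset),
    Finset.sum_eq_single (n, 0)]
  · simp
  · rintro ⟨i, j⟩ hij hne
    obtain ⟨-, rfl, rfl⟩ := (Finset.mem_vaddAntidiagonal _ _).1 hij
    simp at hne
  · intro hn
    have : f.coeff n = 0 := by simpa [Finset.mem_vaddAntidiagonal] using hn
    simp [this]

theorem laurentCoeff_of_isDeriv {X X' : VertexOperator ℂ V} (h : IsDeriv X X') (v : V) (n : ℤ) :
    laurentCoeff n (X' v) = (n + 1) • laurentCoeff (n + 1) (X v) := by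
  rw [← laurentCoeff_moduleEuler, h, laurentCoeff_seriesAction_single, add_sub_cancel_right]

theorem IsDeriv.add {X X' Z Z' : VertexOperator ℂ V} (h : IsDeriv X X') (k : IsDeriv Z Z') :
    IsDeriv (X + Z) (X' + Z') := fun v => by
  simp only [LinearMap.add_apply, map_add, h v, k v]

theorem IsDeriv.smul {X X' : VertexOperator ℂ V} (c : ℂ) (h : IsDeriv X X') :
    IsDeriv (c • X) (c • X') := fun v => by
  simp only [LinearMap.smul_apply, map_smul, moduleEuler_smul, h v]

end Module

/-! ### Residues -/

section Binomial

theorem one_add_X_mul_binomialSeries (s : ℂ) :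
    (1 + PowerSeries.X) * PowerSeries.binomialSeries ℂ s =
      PowerSeries.binomialSeries ℂ (s + 1) := by
  have h := PowerSeries.binomialSeries_nat (R := ℂ) (A := ℂ) 1
  rw [Nat.cast_one, pow_one] at h
  rw [PowerSeries.binomialSeries_add, h, mul_comm]

theorem derivative_binomialSeries (s : ℂ) :
    PowerSeries.derivative ℂ (PowerSeries.binomialSeries ℂ (s + 1)) =
      (s + 1) • PowerSeries.binomialSeries ℂ s := by
  ext n
  have h := Ring.choose_add_smul_choose s n 1
  rw [Nat.choose_one_right, Ring.choose_one_right, nsmul_eq_mul, Nat.cast_one] at h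
  rw [PowerSeries.coeff_derivative, map_smul, PowerSeries.binomialSeries_coeff,
    PowerSeries.binomialSeries_coeff, smul_eq_mul, smul_eq_mul, smul_eq_mul, mul_one, mul_one, ← h,
    mul_comm]
  push_cast
  rfl

end Binomial

section Residue

variable {V : Type*} [AddCommGroup V] [Module ℂ V]

/-- The Laurent series `(1 + z) ^ s z ^ (-k)`. -/
def residueKernel (s : ℂ) (k : ℤ) : HahnSeries ℤ ℂ :=
  HahnSeries.single (-k) 1 * HahnSeries.ofPowerSeries ℤ ℂ (PowerSeries.binomialSeries ℂ s)

theorem residue_eq_laurentCoeff (s : ℂ) (k : ℤ) (f : HahnModule ℤ ℂ V) :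
    residue s k f = laurentCoeff (-1) (seriesAction ℂ V (residueKernel s k) f) := rfl

theorem residue_eq_sum (s : ℂ) (k : ℤ) (f : HahnModule ℤ ℂ V) (N : ℕ)
    (hN : ∀ j : ℕ, N ≤ j → laurentCoeff (k - 1 - j) f = 0) :
    residue s k f = ∑ j ∈ Finset.range N, Ring.choose s j • laurentCoeff (k - 1 - j) f := by
  rw [residue_eq_laurentCoeff, residueKernel, map_mul, Module.End.mul_apply,
    laurentCoeff_seriesAction_single, sub_neg_eq_add, neg_add_eq_sub,
    laurentCoeff_seriesAction_ofPowerSeries _ _ _ N hN]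
  simp only [PowerSeries.binomialSeries_coeff, smul_eq_mul, mul_one]

theorem residue_sub (s : ℂ) (k : ℤ) (f g : HahnModule ℤ ℂ V) :
    residue s k (f - g) = residue s k f - residue s k g := by
  simp only [residue_eq_laurentCoeff, map_sub]

theorem single_one_mul_residueKernel (s : ℂ) (k : ℤ) :
    HahnSeries.single 1 1 * residueKernel s (k + 1) = residueKernel s k := by
  rw [residueKernel, residueKernel, ← mul_assoc, HahnSeries.single_mul_single, one_mul,
    neg_add_rev, add_neg_cancel_left]

theorem residueKernel_add_one (s : ℂ) (k : ℤ) :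
    residueKernel (s + 1) (k + 1) = residueKernel s (k + 1) + residueKernel s k := by
  rw [← single_one_mul_residueKernel s k]
  simp only [residueKernel]
  rw [← one_add_X_mul_binomialSeries, map_mul, map_add, map_one (HahnSeries.ofPowerSeries ℤ ℂ),
    HahnSeries.ofPowerSeries_X]
  ring

theorem euler_residueKernel (s : ℂ) (k : ℤ) :
    euler (residueKernel (s + 1) (k + 1)) =
      HahnSeries.C (s + 1) * residueKernel s k -
        HahnSeries.C ((k : ℂ) + 1) * residueKernel (s + 1) (k + 1) := by
  rw [← single_one_mul_residueKernel s k, residueKernel, euler_mul, euler_single,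
    euler_ofPowerSeries, derivative_binomialSeries, map_mul, HahnSeries.ofPowerSeries_X,
    PowerSeries.smul_eq_C_mul, map_mul, HahnSeries.ofPowerSeries_C, residueKernel,
    map_add _ (k : ℂ), map_intCast, map_one HahnSeries.C]
  push_cast
  ring

/-- Integration by parts: the residue of `d/dz ((1 + z) ^ (s + 1) z ^ (-k) X(z) v)` vanishes. -/
theorem residue_deriv (s : ℂ) (k : ℤ) {X X' : VertexOperator ℂ V} (h : IsDeriv X X') (v : V) :
    residue (s + 1) k (X' v) =
      (k : ℂ) • residue s (k + 1) (X v) + ((k : ℂ) - (s + 1)) • residue s k (X v) := by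
  have total := laurentCoeff_moduleEuler (-1)
    (seriesAction ℂ V (residueKernel (s + 1) (k + 1)) (X v))
  have hC (c : ℂ) (f : HahnSeries ℤ ℂ) : seriesAction ℂ V (HahnSeries.C c * f) =
      c • seriesAction ℂ V f := LinearMap.ext (seriesAction_C_mul c f)
  rw [moduleEuler_seriesAction, h, euler_residueKernel,
    ← Module.End.mul_apply _ (seriesAction ℂ V (HahnSeries.single 1 1)), ← map_mul, mul_comm _
    (HahnSeries.single _ _), single_one_mul_residueKernel, map_sub, hC, hC, neg_one_smul,
    residueKernel_add_one] at total
  simp only [map_add, LinearMap.sub_apply, LinearMap.add_apply, LinearMap.smul_apply, map_sub,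
    map_smul, ← residue_eq_laurentCoeff] at total
  rw [← sub_eq_zero] at total ⊢
  rw [← total]
  module

end Residue

section Zhu

variable {V : Type*} [AddCommGroup V] [Module ℂ V]

theorem mem_sector_two_one {g : V →ₗ[ℂ] V} {u : V} (hu : g u = -u) : u ∈ sector g 2 1 := by
  rw [sector, Module.End.mem_eigenspace_iff, hu,
    show -2 * (Real.pi : ℂ) * Complex.I * (1 : ℕ) / (2 : ℕ) = -(Real.pi * Complex.I) by
      push_cast; ring, Complex.exp_neg, Complex.exp_pi_mul_I, inv_neg, inv_one, neg_one_smul]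

variable {Y : V →ₗ[ℂ] VertexOperator ℂ V} {ω : V} {g : V →ₗ[ℂ] V}

theorem residue_mem_O_of_neg {n : ℤ} {u : V} (hu : g u = -u) (hn : u ∈ weightSpace Y ω n)
    (v : V) : residue ((n : ℂ) - 1 / 2) 1 (Y u v) ∈ O Y ω g 2 := by
  refine Submodule.subset_span ⟨1, n, u, v, one_lt_two, mem_sector_two_one hu, hn, ?_⟩
  simp only [circ, delta, one_ne_zero, if_false, Nat.cast_zero, add_zero, Nat.cast_one,
    Nat.cast_ofNat]
  congr 1
  ring

theorem residue_mem_O {D : V →ₗ[ℂ] V} (hY : ∀ u, IsDeriv (Y u) (Y (D u)))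
    (hD : ∀ (n : ℤ), ∀ u ∈ weightSpace Y ω n, D u ∈ weightSpace Y ω (n + 1))
    (hg : ∀ u, g (D u) = D (g u)) (p : ℕ) {n : ℤ} {u : V} (hu : g u = -u)
    (hn : u ∈ weightSpace Y ω n) (v : V) :
    residue ((n : ℂ) - 1 / 2) (p + 1) (Y u v) ∈ O Y ω g 2 := by
  induction p generalizing n u with
  | zero =>
    rw [Nat.cast_zero, zero_add]
    exact residue_mem_O_of_neg hu hn v
  | succ p ih =>
    have hDu := ih (by rw [hg, hu, map_neg]) (hD n u hn)
    rw [Int.cast_add, Int.cast_one, add_sub_right_comm, residue_deriv _ _ (hY u),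
      Submodule.add_mem_iff_left _ (Submodule.smul_mem _ _ (ih hu hn))] at hDu
    rw [Nat.cast_succ]
    exact (Submodule.smul_mem_iff _ (by exact_mod_cast p.succ_ne_zero)).1 hDu

end Zhu

theorem exists_forall_ge_eq_zero {M : Type*} [Zero M] (f : ℕ →₀ M) :
    ∃ N, ∀ j, N ≤ j → f j = 0 := by
  obtain ⟨N, hN⟩ := Finset.exists_nat_subset_range f.support
  refine ⟨N, fun j hj => Finsupp.notMem_support_iff.1 fun h => ?_⟩
  exact (Finset.mem_range.1 (hN h)).not_ge hj

end TwistedZhu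

namespace LatticeVOA

open TwistedZhu

namespace Fock

variable {L : Type*} [AddCommGroup L]

theorem gen_single (n : ℕ) (h : Cartan L) : gen (Finsupp.single n h) = creation n h := rfl

theorem lift_creation {A : Type*} [Semiring A] [Algebra ℂ A] (f : (ℕ →₀ Cartan L) →ₗ[ℂ] A)
    (hf : ∀ x y, f x * f y = f y * f x) (n : ℕ) (h : Cartan L) :
    lift f hf (creation n h) = f (Finsupp.single n h) :=
  lift_gen f hf _

theorem induction_creation {motive : Fock L → Prop}
    (algebraMap : ∀ r, motive (algebraMap ℂ (Fock L) r))
    (creation : ∀ n h, motive (creation n h))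
    (mul : ∀ a b, motive a → motive b → motive (a * b))
    (add : ∀ a b, motive a → motive b → motive (a + b)) (a : Fock L) : motive a := by
  refine Fock.induction algebraMap (fun x => ?_) mul add a
  induction x using Finsupp.induction_linear with
  | zero => simpa only [map_zero] using algebraMap 0
  | add x y hx hy => rw [map_add]; exact add _ _ hx hy
  | single n h => exact creation n h

theorem derivation_ext {M : Type*} [AddCommMonoid M] [Module ℂ M] [Module (Fock L) M]
    {D₁ D₂ : Derivation ℂ (Fock L) M}
    (H : ∀ n h, D₁ (creation n h) = D₂ (creation n h)) : D₁ = D₂ := by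
  ext P
  induction P using induction_creation with
  | algebraMap r => rw [D₁.map_algebraMap, D₂.map_algebraMap]
  | creation n h => exact H n h
  | mul a b ha hb => rw [D₁.leibniz, D₂.leibniz, ha, hb]
  | add a b ha hb => rw [map_add, map_add, ha, hb]

theorem algHom_ext {A : Type*} [Semiring A] [Algebra ℂ A] {f g : Fock L →ₐ[ℂ] A}
    (H : ∀ n h, f (creation n h) = g (creation n h)) : f = g := by
  ext P
  induction P using induction_creation with
  | algebraMap r => rw [f.commutes, g.commutes]
  | creation n h => exact H n h
  | mul a b ha hb => rw [map_mul, map_mul, ha, hb]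
  | add a b ha hb => rw [map_add, map_add, ha, hb]

/-- The derivation of the symmetric algebra `M(1)` with prescribed values on the generators,
obtained as the second component of an algebra map into the square zero extension. -/
def mkDerivation (f : (ℕ →₀ Cartan L) →ₗ[ℂ] Fock L) : Derivation ℂ (Fock L) (Fock L) :=
  let F : Fock L →ₐ[ℂ] TrivSqZeroExt (Fock L) (Fock L) :=
    Fock.lift ((TrivSqZeroExt.inlAlgHom ℂ (Fock L) (Fock L)).toLinearMap ∘ₗ Fock.gen +
      (TrivSqZeroExt.inrHom (Fock L) (Fock L)).restrictScalars ℂ ∘ₗ f) (fun _ _ => mul_comm _ _)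
  have fst_F : (TrivSqZeroExt.fstHom ℂ (Fock L) (Fock L)).comp F = AlgHom.id ℂ (Fock L) :=
    algHom_ext fun n h => by simp [F, lift_creation, gen_single]
  Derivation.mk' ((TrivSqZeroExt.sndHom (Fock L) (Fock L)).restrictScalars ℂ ∘ₗ F.toLinearMap)
    fun P Q => by
      have hP : (F P).fst = P := DFunLike.congr_fun fst_F P
      have hQ : (F Q).fst = Q := DFunLike.congr_fun fst_F Q
      simp [hP, hQ, mul_comm]

theorem mkDerivation_creation (f : (ℕ →₀ Cartan L) →ₗ[ℂ] Fock L) (n : ℕ) (h : Cartan L) :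
    mkDerivation f (creation n h) = f (Finsupp.single n h) := by
  simp [mkDerivation, lift_creation]

/-- The derivation of `M(1)` by which `L(-1)` acts: `h(-n-1) ↦ (n + 1) h(-n-2)`. -/
def translation : Derivation ℂ (Fock L) (Fock L) :=
  mkDerivation (Finsupp.lsum ℂ fun n => ((n : ℂ) + 1) • creation (n + 1))

/-- The derivation of `M(1)` by which `L(0)` acts: `h(-n-1) ↦ (n + 1) h(-n-1)`. -/
def degree : Derivation ℂ (Fock L) (Fock L) :=
  mkDerivation (Finsupp.lsum ℂ fun n => ((n : ℂ) + 1) • creation n)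

theorem translation_creation (n : ℕ) (h : Cartan L) :
    translation (creation n h) = ((n : ℂ) + 1) • creation (n + 1) h := by
  rw [translation, mkDerivation_creation, Finsupp.lsum_single, LinearMap.smul_apply]

theorem degree_creation (n : ℕ) (h : Cartan L) :
    degree (creation n h) = ((n : ℂ) + 1) • creation n h := by
  rw [degree, mkDerivation_creation, Finsupp.lsum_single, LinearMap.smul_apply]

theorem lie_degree_translation :
    ⁅(degree : Derivation ℂ (Fock L) (Fock L)), (translation : Derivation ℂ (Fock L) (Fock L))⁆ =
      translation :=
  derivation_ext fun n h => by
    rw [Derivation.commutator_apply]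
    simp only [degree_creation, translation_creation, Derivation.map_smul]
    push_cast
    module

end Fock

section Annihilation

variable {L : Type*} [AddCommGroup L] (Λ : EvenLattice L)

/-- The action of `α(i)` on `M(1)` as a derivation. -/
def annihilationDerivation (α : Cartan L) (i : ℕ) : Derivation ℂ (Fock L) (Fock L) :=
  Derivation.mk' (Finsupp.lapply i ∘ₗ annihilationFock Λ α) fun P Q => by
    rw [LinearMap.comp_apply, annihilationFock_mul]
    rfl

theorem annihilationDerivation_apply (α : Cartan L) (i : ℕ) (P : Fock L) :
    annihilationDerivation Λ α i P = annihilationFock Λ α P i := rfl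

theorem annihilationFock_creation (α : Cartan L) (n : ℕ) (h : Cartan L) :
    annihilationFock Λ α (creation n h) =
      Finsupp.single (n + 1) (algebraMap ℂ (Fock L) (((n : ℂ) + 1) * cform Λ α h)) := by
  rw [← Fock.gen_single, annihilationFock_gen, contract, Finsupp.lsum_single]
  rfl

theorem annihilationFock_zero_apply (α : Cartan L) (P : Fock L) :
    annihilationFock Λ α P 0 = 0 := by
  have h : annihilationDerivation Λ α 0 = 0 := Fock.derivation_ext fun n h => by
    rw [annihilationDerivation_apply, annihilationFock_creation,
      Finsupp.single_eq_of_ne (Nat.succ_ne_zero n).symm, Derivation.zero_apply]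
  exact DFunLike.congr_fun h P

end Annihilation

section NormalOrder

variable {L : Type*} [AddCommGroup L] {Λ : EvenLattice L} {G : Type*} [Group G]
  (E : CentralExtension Λ G)

theorem succ_mul_choose_succ (m j : ℕ) :
    (m + 1) * (m + 1 + j).choose (m + 1) = (m + 1 + j) * (m + j).choose m := by
  rw [mul_comm, add_right_comm m 1 j, ← Nat.add_one_mul_choose_eq]

theorem euler_creationSeries_single (m : ℕ) (h : Cartan L) :
    euler (creationSeries (Finsupp.single m h)) = HahnSeries.single 1 1 *
      (HahnSeries.C (algebraMap ℂ (Fock L) (m + 1)) *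
        creationSeries (Finsupp.single (m + 1) h)) := by
  rw [creationSeries, euler_ofPowerSeries, map_mul, HahnSeries.ofPowerSeries_X, creationSeries,
    ← HahnSeries.ofPowerSeries_C, ← map_mul (HahnSeries.ofPowerSeries ℤ (Fock L))]
  congr 2
  ext j
  have hc : (m + (j + 1)).choose m * (j + 1) = (m + 1) * (m + 1 + j).choose (m + 1) := by
    rw [add_right_comm m 1 j, add_assoc, mul_comm (m + 1), Nat.choose_succ_right_eq]
    simp
  have hc' : ((m + (j + 1)).choose m : ℂ) * (j + 1) = (m + 1) * (m + 1 + j).choose (m + 1) := by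
    exact_mod_cast hc
  rw [PowerSeries.coeff_derivative, PowerSeries.coeff_C_mul, PowerSeries.coeff_mk,
    PowerSeries.coeff_mk, Finsupp.lsum_single, Finsupp.lsum_single, LinearMap.smul_apply,
    LinearMap.smul_apply, ← Algebra.smul_def, smul_smul, ← hc', mul_comm (_ : ℂ), mul_smul,
    Algebra.smul_def ((j : ℂ) + 1), mul_comm, add_right_comm m 1 j, add_assoc]
  simp

theorem isDeriv_normalOrder_single (m : ℕ) (h : Cartan L) {X X' : VertexOperator ℂ (VL E)}
    (hX : IsDeriv X X') : IsDeriv (normalOrder E (Finsupp.single m h) X)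
      (((m : ℂ) + 1) • normalOrder E (Finsupp.single (m + 1) h) X +
        normalOrder E (Finsupp.single m h) X') := by
  intro v
  obtain ⟨N, hN⟩ := exists_forall_ge_eq_zero (annihilation E h v)
  have term (j : ℕ) (w : VL E) : moduleEuler (((-1) ^ m * ((m + j).choose m : ℂ)) •
      seriesAction (Fock L) (VL E) (HahnSeries.single (-(m : ℤ) - 1 - j) 1) (X w)) =
      seriesAction ℂ (VL E) (HahnSeries.single 1 1)
        (((m : ℂ) + 1) • ((-1) ^ (m + 1) * ((m + 1 + j).choose (m + 1) : ℂ)) •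
          seriesAction (Fock L) (VL E) (HahnSeries.single (-((m + 1 : ℕ) : ℤ) - 1 - j) 1) (X w) +
        ((-1) ^ m * ((m + j).choose m : ℂ)) • seriesAction (Fock L) (VL E)
          (HahnSeries.single (-(m : ℤ) - 1 - j) 1) (X' w)) := by
    have hc : ((m : ℂ) + 1) * (m + 1 + j).choose (m + 1) = (m + 1 + j) * (m + j).choose m := by
      exact_mod_cast succ_mul_choose_succ m j
    refine laurentCoeff_ext fun n => ?_
    have hn : n - 1 - (-((m + 1 : ℕ) : ℤ) - 1 - j) = n - (-(m : ℤ) - 1 - j) := by push_cast; ring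
    have hX' := laurentCoeff_of_isDeriv hX w (n - 1 - (-(m : ℤ) - 1 - j))
    rw [show n - 1 - (-(m : ℤ) - 1 - j) + 1 = n - (-(m : ℤ) - 1 - j) by ring] at hX'
    simp only [laurentCoeff_moduleEuler, laurentCoeff_seriesAction_single, map_add, map_smul, hn,
      hX', ← Int.cast_smul_eq_zsmul ℂ, smul_smul, ← add_smul]
    congr 1
    push_cast
    linear_combination (-1) ^ m * hc
  have creation_term : moduleEuler
      (seriesAction (Fock L) (VL E) (creationSeries (Finsupp.single m h)) (X v)) =
      seriesAction ℂ (VL E) (HahnSeries.single 1 1)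
        (((m : ℂ) + 1) • seriesAction (Fock L) (VL E)
          (creationSeries (Finsupp.single (m + 1) h)) (X v) +
        seriesAction (Fock L) (VL E) (creationSeries (Finsupp.single m h)) (X' v)) := by
    rw [moduleEuler_seriesAction, euler_creationSeries_single, hX v, map_mul,
      Module.End.mul_apply, seriesAction_C_mul, map_add, seriesAction_single_algebraMap]
    congr 1
    rw [← seriesAction_single_algebraMap (S := Fock L), ← Module.End.mul_apply,
      ← Module.End.mul_apply, ← map_mul, ← map_mul, mul_comm]
  simp only [LinearMap.add_apply, LinearMap.smul_apply, normalOrder_single E _ N h _ v hN]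
  rw [map_add, map_sum, creation_term]
  simp only [term, map_add, map_sum, map_smul, smul_add, Finset.smul_sum, Finset.sum_add_distrib]
  abel

theorem isDeriv_normalOrderFock (P : Fock L) {X X' : VertexOperator ℂ (VL E)}
    (hX : IsDeriv X X') : IsDeriv (normalOrderFock E P X)
      (normalOrderFock E (Fock.translation P) X + normalOrderFock E P X') := by
  induction P using Fock.induction_creation generalizing X X' with
  | algebraMap r =>
    rw [Derivation.map_algebraMap, map_zero, LinearMap.zero_apply, zero_add, AlgHom.commutes]
    exact hX.smul r
  | creation n h =>
    rw [Fock.translation_creation, map_smul, normalOrderFock, Fock.lift_creation,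
      Fock.lift_creation]
    exact isDeriv_normalOrder_single E n h hX
  | mul a b ha hb =>
    have key := ha (hb hX)
    rw [map_add] at key
    rw [Derivation.leibniz, map_add, smul_eq_mul, smul_eq_mul, mul_comm b, map_mul, map_mul,
      map_mul]
    simp only [LinearMap.add_apply, Module.End.mul_apply]
    convert key using 1
    abel
  | add a b ha hb =>
    convert (ha hX).add (hb hX) using 1
    · rw [map_add, LinearMap.add_apply]
    · simp only [map_add, LinearMap.add_apply]
      abel

end NormalOrder

end LatticeVOA

namespace TwistedZhu

section PowerSeries

open PowerSeries Finset.HasAntidiagonal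

variable {R : Type*} [CommRing R]

variable {A B : Type*} [CommRing A] [Algebra R A] [CommRing B] [Algebra R B]

/-- A linear map applied to the coefficients of a power series. -/
def mapCoeff (ℓ : A →ₗ[R] B) (f : A⟦X⟧) : B⟦X⟧ := mk fun n => ℓ (coeff n f)

theorem coeff_mapCoeff (ℓ : A →ₗ[R] B) (f : A⟦X⟧) (n : ℕ) :
    coeff n (mapCoeff ℓ f) = ℓ (coeff n f) :=
  coeff_mk _ _

theorem derivative_mapCoeff (ℓ : A →ₗ[R] B) (f : A⟦X⟧) :
    derivative B (mapCoeff ℓ f) = mapCoeff ℓ (derivative A f) := by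
  ext n
  simp only [coeff_derivative, coeff_mapCoeff]
  rw [← Nat.cast_add_one, ← Nat.cast_add_one, mul_comm, mul_comm (coeff (n + 1) f),
    ← nsmul_eq_mul, ← nsmul_eq_mul, map_nsmul]

theorem mapCoeff_mul (D : Derivation R A A) (f g : A⟦X⟧) :
    mapCoeff (D : A →ₗ[R] A) (f * g) =
      f * mapCoeff (D : A →ₗ[R] A) g + mapCoeff (D : A →ₗ[R] A) f * g := by
  ext n
  simp only [coeff_mapCoeff, coeff_mul, map_add, map_sum, Derivation.coeFn_coe,
    Derivation.leibniz, smul_eq_mul, Finset.sum_add_distrib]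
  simp only [mul_comm (coeff _ g)]

theorem eq_C_mul_of_mul_derivative_eq [IsAddTorsionFree R] {s r f g : R⟦X⟧} (hs : IsUnit s)
    (hf : s * derivative R f = r * f) (hg : s * derivative R g = r * g)
    (hg1 : constantCoeff g = 1) : f = C (constantCoeff f) * g := by
  obtain ⟨h, hgh⟩ := (isUnit_iff_constantCoeff.2 (hg1 ▸ isUnit_one) : IsUnit g).exists_right_inv
  have hh : derivative R g * h + g * derivative R h = 0 := by
    have := congrArg (derivative R) hgh
    rw [Derivation.leibniz, derivative_one, smul_eq_mul, smul_eq_mul] at this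
    linear_combination this
  have hfh : derivative R (f * h) = 0 := hs.mul_left_cancel (by
    rw [Derivation.leibniz, smul_eq_mul, smul_eq_mul]
    linear_combination h * hf - f * h * h * hg + s * f * h * hh -
      (s * f * derivative R h + r * f * h) * hgh)
  have hconst : f * h = C (constantCoeff f) := by
    refine derivative.ext (by rw [hfh, derivative_C]) ?_
    have := congrArg constantCoeff hgh
    rw [map_mul, hg1, one_mul, constantCoeff_one] at this
    rw [map_mul, this, mul_one, constantCoeff_C]
  rw [← hconst, mul_assoc, mul_comm h, hgh, mul_one]

end PowerSeries

end TwistedZhu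

namespace LatticeVOA

open TwistedZhu

section ExpSeries

variable {L : Type*} [AddCommGroup L]

/-- The exponent `∑_{n > 0} h(-n) z^n / n` in the vertex operators. -/
def creationExponent (h : Cartan L) : PowerSeries (Fock L) :=
  PowerSeries.mk fun n => if n = 0 then 0 else (n : ℂ)⁻¹ • creation (n - 1) h

/-- The series `exp(∑_{n > 0} h(-n) z^n / n)`, whose coefficients are the Schur polynomials in the
`h(-n)`. -/
def expSeries (h : Cartan L) : PowerSeries (Fock L) :=
  (PowerSeries.exp ℂ).subst (creationExponent h)

/-- The creation part `∑_{n ≥ 0} h(-n-1) z^n` of the field `h(z)`. -/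
def creationPart (h : Cartan L) : PowerSeries (Fock L) :=
  PowerSeries.mk fun n => creation n h

theorem constantCoeff_creationExponent (h : Cartan L) :
    PowerSeries.constantCoeff (creationExponent h) = 0 := by
  rw [← PowerSeries.coeff_zero_eq_constantCoeff_apply, creationExponent, PowerSeries.coeff_mk,
    if_pos rfl]

theorem hasSubst_creationExponent (h : Cartan L) :
    PowerSeries.HasSubst (creationExponent h) :=
  PowerSeries.HasSubst.of_constantCoeff_zero' (constantCoeff_creationExponent h)

theorem derivative_creationExponent (h : Cartan L) :
    PowerSeries.derivative (Fock L) (creationExponent h) = creationPart h := by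
  ext n
  have hn : ((n + 1 : ℕ) : ℂ) ≠ 0 := Nat.cast_ne_zero.2 n.succ_ne_zero
  rw [PowerSeries.coeff_derivative, creationExponent, PowerSeries.coeff_mk, if_neg n.succ_ne_zero,
    creationPart, PowerSeries.coeff_mk, ← Nat.cast_add_one, mul_comm, ← nsmul_eq_mul,
    ← Nat.cast_smul_eq_nsmul ℂ, smul_smul, mul_inv_cancel₀ hn, one_smul, Nat.add_sub_cancel]

theorem derivative_expSeries (h : Cartan L) :
    PowerSeries.derivative (Fock L) (expSeries h) = creationPart h * expSeries h := by
  let _ : Algebra ℚ (Fock L) := Algebra.compHom _ (algebraMap ℚ ℂ)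
  have hexp : expSeries h = (PowerSeries.exp (Fock L)).subst (creationExponent h) := by
    rw [← PowerSeries.map_exp (algebraMap ℂ (Fock L)), PowerSeries.map_algebraMap_eq_subst_X,
      PowerSeries.subst_comp_subst_apply PowerSeries.HasSubst.X' (hasSubst_creationExponent h),
      PowerSeries.subst_X (hasSubst_creationExponent h), expSeries]
  rw [hexp, PowerSeries.derivative_subst (hasSubst_creationExponent h), PowerSeries.derivative_exp,
    derivative_creationExponent, mul_comm]

theorem constantCoeff_expSeries (h : Cartan L) :
    PowerSeries.constantCoeff (expSeries h) = 1 := by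
  rw [← PowerSeries.coeff_zero_eq_constantCoeff_apply, expSeries,
    PowerSeries.coeff_subst' (hasSubst_creationExponent h), finsum_eq_single _ 0]
  · simp
  · intro d hd
    rw [PowerSeries.coeff_zero_eq_constantCoeff_apply, map_pow, constantCoeff_creationExponent,
      zero_pow hd, smul_zero]

theorem annihilationDerivation_creationPart (Λ : EvenLattice L) (α h : Cartan L) (i : ℕ) :
    mapCoeff (annihilationDerivation Λ α (i + 1) : Fock L →ₗ[ℂ] Fock L) (creationPart h) =
      PowerSeries.derivative _
        (PowerSeries.C (algebraMap ℂ (Fock L) (cform Λ α h)) * PowerSeries.X ^ (i + 1)) := by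
  ext n
  rw [coeff_mapCoeff, creationPart, PowerSeries.coeff_mk, Derivation.coeFn_coe,
    annihilationDerivation_apply, annihilationFock_creation, PowerSeries.coeff_derivative,
    PowerSeries.coeff_C_mul, PowerSeries.coeff_X_pow]
  rcases eq_or_ne n i with rfl | hn
  · rw [Finsupp.single_eq_same, if_pos rfl, map_mul, map_add, map_natCast, map_one]
    ring
  · rw [Finsupp.single_eq_of_ne (by omega), if_neg (by omega)]
    ring

theorem annihilationDerivation_expSeries (Λ : EvenLattice L) (α h : Cartan L) (i : ℕ) :
    mapCoeff (annihilationDerivation Λ α (i + 1) : Fock L →ₗ[ℂ] Fock L) (expSeries h) =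
      PowerSeries.C (algebraMap ℂ (Fock L) (cform Λ α h)) * PowerSeries.X ^ (i + 1) *
        expSeries h := by
  let _ : Algebra ℚ (Fock L) := Algebra.compHom _ (algebraMap ℚ ℂ)
  have : IsAddTorsionFree (Fock L) := .of_module_rat _
  set D := (annihilationDerivation Λ α (i + 1)).toLinearMap
  set c := PowerSeries.C (algebraMap ℂ (Fock L) (cform Λ α h)) * PowerSeries.X ^ (i + 1)
  have hode : 1 * PowerSeries.derivative _ (mapCoeff D (expSeries h) - c * expSeries h) =
      creationPart h * (mapCoeff D (expSeries h) - c * expSeries h) := by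
    rw [map_sub, derivative_mapCoeff, derivative_expSeries, mapCoeff_mul,
      annihilationDerivation_creationPart, Derivation.leibniz _ c, derivative_expSeries,
      smul_eq_mul, smul_eq_mul]
    ring
  have hconst : PowerSeries.constantCoeff (mapCoeff D (expSeries h) - c * expSeries h) = 0 := by
    rw [map_sub, ← PowerSeries.coeff_zero_eq_constantCoeff_apply, coeff_mapCoeff,
      PowerSeries.coeff_zero_eq_constantCoeff_apply, constantCoeff_expSeries]
    simp [D, c]
  have hzero := eq_C_mul_of_mul_derivative_eq isUnit_one hode
    (by rw [one_mul, derivative_expSeries]) (constantCoeff_expSeries h)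
  rwa [hconst, map_zero, zero_mul, sub_eq_zero] at hzero

end ExpSeries

/-! ### The vertex operators of the vectors `ι(a)` -/

section VertexIota

variable {L : Type*} [AddCommGroup L] {Λ : EvenLattice L} {G : Type*} [Group G]
  (E : CentralExtension Λ G)

/-- The element `1 ⊗ ā` of `𝔥`. -/
abbrev cbar (a : G) : Cartan L := 1 ⊗ₜ bar E a

theorem cform_tmul (α β : L) : cform Λ (1 ⊗ₜ α) (1 ⊗ₜ β) = (Λ.form α β : ℂ) := by
  simp [cform]

/-- The operator `exp(-∑_{n > 0} ā(n) z^(-n) / n) : M(1) → M(1)((z))`. -/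
def annihilationExp (a : G) : Fock L →+* HahnSeries ℤ (Fock L) :=
  polynomialToSeries.comp (expAnnihilation E a : Fock L →+* Polynomial (Fock L))

theorem annihilationExp_algebraMap (a : G) (c : ℂ) :
    annihilationExp E a (algebraMap ℂ (Fock L) c) = HahnSeries.C (algebraMap ℂ (Fock L) c) := by
  simp [annihilationExp, polynomialToSeries, Polynomial.algebraMap_apply]

theorem annihilationExp_creation (a : G) (n : ℕ) (h : Cartan L) :
    annihilationExp E a (creation n h) = HahnSeries.C (creation n h) -
      HahnSeries.single (-((n : ℤ) + 1)) (algebraMap ℂ (Fock L) (cform Λ (cbar E a) h)) := by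
  have hpoly : expAnnihilation E a (creation n h) = Polynomial.C (creation n h) -
      Polynomial.C (algebraMap ℂ (Fock L) (cform Λ (cbar E a) h)) * Polynomial.X ^ (n + 1) := by
    rw [expAnnihilation, Fock.lift_creation]
    simp [Algebra.smul_def, Polynomial.algebraMap_apply]
  rw [annihilationExp, RingHom.comp_apply, RingHom.coe_coe, hpoly]
  simp [polynomialToSeries, HahnSeries.single_pow]

theorem euler_annihilationExp (a : G) (Q : Fock L) :
    euler (annihilationExp E a Q) = (annihilationFock Λ (cbar E a) Q).sum
      fun j w => HahnSeries.single (-(j : ℤ)) 1 * annihilationExp E a w := by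
  induction Q using Fock.induction_creation with
  | algebraMap r =>
    rw [annihilationExp_algebraMap, annihilationFock_algebraMap, Finsupp.sum_zero_index,
      HahnSeries.C_apply, euler_single, Int.cast_zero, zero_mul]
  | creation n h =>
    rw [annihilationExp_creation, map_sub, annihilationFock_creation,
      Finsupp.sum_single_index (by rw [map_zero, mul_zero]), annihilationExp_algebraMap,
      HahnSeries.C_apply, HahnSeries.C_apply, euler_single, euler_single, Int.cast_zero, zero_mul,
      zero_sub, ← map_intCast (HahnSeries.C : Fock L →+* HahnSeries ℤ (Fock L)),
      HahnSeries.C_apply, HahnSeries.single_mul_single, HahnSeries.single_mul_single,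
      ← HahnSeries.single_neg, zero_add, add_zero, one_mul, Nat.cast_succ,
      map_mul (algebraMap ℂ (Fock L))]
    congr 1
    push_cast
    ring
  | mul P Q hP hQ =>
    rw [map_mul, euler_mul, hP, hQ, annihilationFock_mul, Finsupp.sum_add_index'
      (fun _ => by rw [map_zero, mul_zero]) (fun _ _ _ => by rw [map_add, mul_add]),
      Finsupp.sum_smul_index' (fun _ => by rw [map_zero, mul_zero]),
      Finsupp.sum_smul_index' (fun _ => by rw [map_zero, mul_zero])]
    simp only [smul_eq_mul, map_mul, mul_left_comm (HahnSeries.single _ _), ← Finsupp.mul_sum]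
    ring
  | add P Q hP hQ =>
    rw [map_add, map_add, map_add, hP, hQ, Finsupp.sum_add_index'
      (fun _ => by rw [map_zero, mul_zero]) (fun _ _ _ => by rw [map_add, mul_add])]

/-- The series `f` with `Y(ι(a), z) (Q ⊗ ι(b)) = f(z) ι(ab)`. -/
def iotaSeries (a b : G) (Q : Fock L) : HahnSeries ℤ (Fock L) :=
  HahnSeries.single (Λ.form (bar E a) (bar E b)) 1 *
    HahnSeries.ofPowerSeries ℤ (Fock L) (expSeries (cbar E a)) * annihilationExp E a Q

theorem vertexIota_apply (a b : G) (Q : Fock L) :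
    vertexIota E a (Q ⊗ₜ tw E b) = seriesAction (Fock L) (VL E) (iotaSeries E a b Q)
      (constSeries (VL E) (iota E (a * b))) :=
  vertexIota_tmul E a b Q

theorem euler_iotaSeries (a b : G) (Q : Fock L) (N : ℕ)
    (hN : ∀ j, N ≤ j → annihilationFock Λ (cbar E a) Q j = 0) :
    euler (iotaSeries E a b Q) =
      HahnSeries.C (algebraMap ℂ (Fock L) (cform Λ (cbar E a) (cbar E b))) * iotaSeries E a b Q +
      HahnSeries.single 1 1 * (HahnSeries.ofPowerSeries ℤ (Fock L) (creationPart (cbar E a)) *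
        iotaSeries E a b Q) +
      ∑ j ∈ Finset.range N, HahnSeries.single (-(j : ℤ)) 1 *
        iotaSeries E a b (annihilationFock Λ (cbar E a) Q j) := by
  have hsupp : (annihilationFock Λ (cbar E a) Q).support ⊆ Finset.range N := fun j hj =>
    Finset.mem_range.2 (not_le.1 fun hj' => Finsupp.mem_support_iff.1 hj (hN j hj'))
  simp only [iotaSeries]
  rw [euler_mul, euler_mul, euler_single, euler_ofPowerSeries, derivative_expSeries, map_mul,
    map_mul, HahnSeries.ofPowerSeries_X, euler_annihilationExp,
    Finsupp.sum_of_support_subset _ hsupp _ (fun _ _ => by rw [map_zero, mul_zero]),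
    Finset.mul_sum, cform_tmul, map_intCast, map_intCast]
  simp only [mul_left_comm _ (HahnSeries.single (-_) _)]
  ring

theorem VL_induction {motive : VL E → Prop} (tmul : ∀ Q b, motive (Q ⊗ₜ tw E b))
    (add : ∀ v w, motive v → motive w → motive (v + w)) (v : VL E) : motive v := by
  have hspan : Submodule.span ℂ (Set.range (tw E)) = ⊤ := by
    rw [← Submodule.ker_mkQ (Submodule.span ℂ (Set.range (tw E))), LinearMap.ker_eq_top]
    exact tw_ext E fun b => (Submodule.Quotient.mk_eq_zero _).2 (Submodule.subset_span ⟨b, rfl⟩)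
  have zero : motive 0 := by simpa only [TensorProduct.zero_tmul] using tmul 0 1
  induction v using TensorProduct.induction_on with
  | zero => exact zero
  | add v w hv hw => exact add v w hv hw
  | tmul Q x =>
    have hx : x ∈ Submodule.span ℂ (Set.range (tw E)) := hspan ▸ Submodule.mem_top
    induction hx using Submodule.span_induction generalizing Q with
    | mem _ hx => obtain ⟨b, rfl⟩ := hx; exact tmul Q b
    | zero => rwa [TensorProduct.tmul_zero]
    | add x y _ _ hx hy => rw [TensorProduct.tmul_add]; exact add _ _ (hx Q) (hy Q)
    | smul c x _ hx => rw [← TensorProduct.smul_tmul]; exact hx (c • Q)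

theorem creationSeries_single_zero (h : Cartan L) :
    creationSeries (Finsupp.single 0 h) =
      HahnSeries.ofPowerSeries ℤ (Fock L) (creationPart h) := by
  simp [creationSeries, creationPart]

theorem isDeriv_vertexIota (a : G) :
    IsDeriv (vertexIota E a) (normalOrder E (Finsupp.single 0 (cbar E a)) (vertexIota E a)) := by
  intro v
  induction v using VL_induction E with
  | add v w hv hw => simp only [map_add, hv, hw]
  | tmul Q b =>
    obtain ⟨N, hN⟩ := exists_forall_ge_eq_zero (annihilationFock Λ (cbar E a) Q)
    have hN' (j : ℕ) (hj : N + 1 ≤ j) : annihilation E (cbar E a) (Q ⊗ₜ tw E b) j = 0 := by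
      rw [annihilation_tmul, hN j (by omega), if_neg (by omega), TensorProduct.zero_tmul,
        zero_smul, add_zero]
    rw [normalOrder_single E 0 (N + 1) _ _ _ hN', creationSeries_single_zero, vertexIota_apply,
      moduleEuler_seriesAction, moduleEuler_constSeries, map_zero, add_zero,
      euler_iotaSeries E a b Q (N + 1) fun j hj => hN j (by omega)]
    refine laurentCoeff_ext fun n => ?_
    have hshift (j : ℕ) : n - 1 - (-((0 : ℕ) : ℤ) - 1 - j) = n - -(j : ℤ) := by push_cast; ring
    rw [map_add, map_add, LinearMap.add_apply, LinearMap.add_apply, seriesAction_C_mul]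
    simp only [annihilation_tmul, map_add, map_sum, map_smul, LinearMap.sum_apply, map_mul,
      Module.End.mul_apply, vertexIota_apply, laurentCoeff_seriesAction_single, hshift,
      Finset.sum_add_distrib, zero_add, Nat.choose_zero_right, pow_zero, Nat.cast_one, mul_one,
      one_smul]
    simp only [ite_smul, zero_smul]
    rw [Finset.sum_ite_eq', if_pos (Finset.mem_range.2 N.succ_pos)]
    simp only [Nat.cast_zero, neg_zero, sub_zero]
    abel

/-- The operator `P ⊗ ι(a) ↦ ā(-1) P ⊗ ι(a)`. -/
def barCreation : VL E →ₗ[ℂ] VL E :=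
  TensorProduct.lift (LinearMap.flip (twLift E
    (fun a => (TensorProduct.mk ℂ (Fock L) (TwistedGroupAlgebra E)).flip (tw E a) ∘ₗ
      LinearMap.mulLeft ℂ (creation 0 (cbar E a)))
    (fun a => by
      apply LinearMap.ext
      intro Q
      simp [cbar, bar_neg_mul, tw_neg])))

theorem barCreation_tmul (P : Fock L) (a : G) :
    barCreation E (P ⊗ₜ tw E a) = (creation 0 (cbar E a) * P) ⊗ₜ tw E a := by
  simp [barCreation, twLift_tw]

/-- The operator `L(-1)` of `V_L`. -/
def translate : VL E →ₗ[ℂ] VL E :=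
  Fock.translation.toLinearMap.rTensor (TwistedGroupAlgebra E) + barCreation E

theorem translate_tmul (P : Fock L) (a : G) :
    translate E (P ⊗ₜ tw E a) =
      (Fock.translation P + creation 0 (cbar E a) * P) ⊗ₜ tw E a := by
  rw [translate, LinearMap.add_apply, barCreation_tmul, LinearMap.rTensor_tmul,
    TensorProduct.add_tmul, Derivation.coeFn_coe]

theorem Y_tmul (P : Fock L) (a : G) :
    Y E (P ⊗ₜ tw E a) = normalOrderFock E P (vertexIota E a) := by
  simp [Y, vertexTw, twLift_tw]

theorem isDeriv_Y_translate (u : VL E) : IsDeriv (Y E u) (Y E (translate E u)) := by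
  induction u using VL_induction E with
  | add u w hu hw => rw [map_add, map_add, map_add]; exact hu.add hw
  | tmul P a =>
    have h := isDeriv_normalOrderFock E P (isDeriv_vertexIota E a)
    rwa [translate_tmul, Y_tmul, Y_tmul, map_add, LinearMap.add_apply, mul_comm, map_mul,
      Module.End.mul_apply, normalOrderFock, Fock.lift_creation]

end VertexIota

/-! ### Weights -/

section Weight

variable {L : Type*} [AddCommGroup L] {Λ : EvenLattice L} {G : Type*} [Group G]
  (E : CentralExtension Λ G)

theorem bar_one : bar E 1 = 0 := by simp [bar]

theorem bar_mul (a b : G) : bar E (a * b) = bar E a + bar E b := by simp [bar]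

theorem bar_inv (a : G) : bar E a⁻¹ = -bar E a := by simp [bar]

theorem cbar_one : cbar E 1 = 0 := by rw [cbar, bar_one, TensorProduct.tmul_zero]

theorem expSeries_zero : expSeries (0 : Cartan L) = 1 := by
  have h : creationPart (0 : Cartan L) = 0 := by
    ext n
    rw [creationPart, PowerSeries.coeff_mk, map_zero, map_zero]
  let _ : Algebra ℚ (Fock L) := Algebra.compHom _ (algebraMap ℚ ℂ)
  have : IsAddTorsionFree (Fock L) := .of_module_rat _
  refine PowerSeries.derivative.ext ?_ ?_
  · rw [derivative_expSeries, h, zero_mul, PowerSeries.derivative_one]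
  · rw [constantCoeff_expSeries, map_one]

theorem annihilationExp_one (Q : Fock L) : annihilationExp E 1 Q = HahnSeries.C Q := by
  induction Q using Fock.induction_creation with
  | algebraMap r => rw [annihilationExp_algebraMap]
  | creation n h =>
    rw [annihilationExp_creation, cbar_one, map_zero, LinearMap.zero_apply, map_zero, map_zero,
      sub_zero]
  | mul P Q hP hQ => rw [map_mul, hP, hQ, map_mul]
  | add P Q hP hQ => rw [map_add, hP, hQ, map_add]

theorem vertexIota_one : vertexIota E 1 = constSeries (VL E) := by
  refine VL_ext E fun Q b => laurentCoeff_ext fun n => ?_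
  rw [vertexIota_apply, laurentCoeff_seriesAction_constSeries, iotaSeries, annihilationExp_one,
    cbar_one, expSeries_zero, bar_one, map_zero, LinearMap.zero_apply, HahnSeries.single_zero_one,
    map_one, one_mul, one_mul, one_mul, HahnSeries.C_apply]
  change _ = (HahnSeries.single 0 (Q ⊗ₜ tw E b)).coeff n
  rw [HahnSeries.coeff_single, HahnSeries.coeff_single]
  split_ifs
  · rw [iota, TensorProduct.smul_tmul', smul_eq_mul, mul_one]
  · rw [zero_smul]

/-- The vertex operator `h(z) = ∑ h(n) z^(-n-1)`. -/
def heisenberg (h : Cartan L) : VertexOperator ℂ (VL E) :=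
  normalOrder E (Finsupp.single 0 h) (constSeries (VL E))

theorem Y_creation (n : ℕ) (h : Cartan L) :
    Y E (creation n h ⊗ₜ tw E 1) = normalOrder E (Finsupp.single n h) (constSeries (VL E)) := by
  rw [Y_tmul, normalOrderFock, Fock.lift_creation, vertexIota_one]

theorem laurentCoeff_heisenberg (h : Cartan L) (n : ℤ) (v : VL E) (N : ℕ)
    (hN : ∀ j, N ≤ j → annihilation E h v j = 0) :
    laurentCoeff n (heisenberg E h v) =
      (HahnSeries.ofPowerSeries ℤ (Fock L) (creationPart h)).coeff n • v +
        ∑ j ∈ Finset.range N, if n = -1 - j then annihilation E h v j else 0 := by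
  rw [heisenberg, normalOrder_single E 0 N h _ v hN, creationSeries_single_zero, map_add, map_sum,
    laurentCoeff_seriesAction_constSeries]
  simp only [laurentCoeff_seriesAction_constSeries, HahnSeries.coeff_single, pow_zero,
    Nat.choose_zero_right, Nat.cast_one, one_mul, one_smul, ite_smul, zero_smul, Nat.cast_zero,
    neg_zero, zero_sub]

theorem laurentCoeff_heisenberg_natCast (h : Cartan L) (k : ℕ) (v : VL E) :
    laurentCoeff k (heisenberg E h v) = creation k h • v := by
  obtain ⟨N, hN⟩ := exists_forall_ge_eq_zero (annihilation E h v)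
  rw [laurentCoeff_heisenberg E h _ v N hN, Finset.sum_eq_zero fun j _ => if_neg (by omega),
    add_zero, HahnSeries.ofPowerSeries_apply_coeff, creationPart, PowerSeries.coeff_mk]

theorem laurentCoeff_heisenberg_neg (h : Cartan L) (k : ℕ) (v : VL E) :
    laurentCoeff (-1 - k) (heisenberg E h v) = annihilation E h v k := by
  obtain ⟨N, hN⟩ := exists_forall_ge_eq_zero (annihilation E h v)
  rw [laurentCoeff_heisenberg E h _ v (N + k + 1) fun j hj => hN j (by omega),
    PowerSeries.coeff_coe, if_pos (by omega), zero_smul, zero_add,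
    Finset.sum_eq_single_of_mem k (Finset.mem_range.2 (by omega)) fun j _ hj =>
      if_neg (by omega), if_pos rfl]

theorem laurentCoeff_normalOrder_heisenberg (h : Cartan L) (v : VL E) (N : ℕ)
    (hN : ∀ j, N ≤ j → annihilation E h v j = 0) :
    laurentCoeff (-2) (normalOrder E (Finsupp.single 0 h) (heisenberg E h) v) =
      annihilation E h (annihilation E h v 0) 0 +
        (2 : ℂ) • ∑ j ∈ Finset.range N, creation j h • annihilation E h v (j + 1) := by
  have hneg (j : ℕ) : (-2 : ℤ) - j = -1 - ((j + 1 : ℕ) : ℤ) := by push_cast; ring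
  have hpos (j : ℕ) : (-2 : ℤ) - (-((0 : ℕ) : ℤ) - 1 - (j + 1 : ℕ)) = j := by push_cast; ring
  have hzero : (-2 : ℤ) - (-((0 : ℕ) : ℤ) - 1 - (0 : ℕ)) = -1 - ((0 : ℕ) : ℤ) := by norm_num
  rw [normalOrder_single E 0 (N + 1) h _ v fun j hj => hN j (by omega),
    creationSeries_single_zero, map_add, map_sum, laurentCoeff_seriesAction_ofPowerSeries _ _ _ N
      fun j hj => by rw [hneg, laurentCoeff_heisenberg_neg, hN _ (by omega)],
    Finset.sum_range_succ']
  simp only [laurentCoeff_seriesAction_single, hneg, hpos, hzero,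
    laurentCoeff_heisenberg_neg, laurentCoeff_heisenberg_natCast, creationPart,
    PowerSeries.coeff_mk, pow_zero, zero_add, Nat.choose_zero_right, Nat.cast_one, mul_one,
    one_smul, two_smul]
  abel

/-- `(w_j)_j ↦ ∑_{j > 0} h(-j) w_j`; the entry `w_0` is only ever zero. -/
def creationSum (h : Cartan L) : (ℕ →₀ Fock L) →ₗ[Fock L] Fock L :=
  Finsupp.linearCombination (Fock L) fun j => creation (j - 1) h

theorem creationSum_annihilationFock (h : Cartan L) (P : Fock L) (N : ℕ)
    (hN : ∀ j, N ≤ j → annihilationFock Λ h P j = 0) :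
    creationSum h (annihilationFock Λ h P) =
      ∑ j ∈ Finset.range N, creation j h * annihilationFock Λ h P (j + 1) := by
  have hsupp : (annihilationFock Λ h P).support ⊆ Finset.range (N + 1) := fun j hj =>
    Finset.mem_range.2 (not_le.1 fun hj' => Finsupp.mem_support_iff.1 hj (hN j (by omega)))
  rw [creationSum, Finsupp.linearCombination_apply,
    Finsupp.sum_of_support_subset _ hsupp _ fun _ _ => by rw [zero_smul], Finset.sum_range_succ',
    annihilationFock_zero_apply, zero_smul, add_zero]
  simp only [smul_eq_mul, mul_comm, Nat.add_sub_cancel]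

theorem laurentCoeff_normalOrder_heisenberg_tmul (h : Cartan L) (P : Fock L) (a : G) :
    laurentCoeff (-2) (normalOrder E (Finsupp.single 0 h) (heisenberg E h) (P ⊗ₜ tw E a)) =
      ((cform Λ h (cbar E a) * cform Λ h (cbar E a)) • P +
        (2 : ℂ) • creationSum h (annihilationFock Λ h P)) ⊗ₜ tw E a := by
  obtain ⟨N, hN⟩ := exists_forall_ge_eq_zero (annihilationFock Λ h P)
  rw [laurentCoeff_normalOrder_heisenberg E h _ (N + 1) fun j hj => by
      rw [annihilation_tmul, hN j (by omega), if_neg (by omega), TensorProduct.zero_tmul,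
        zero_smul, add_zero],
    creationSum_annihilationFock h P (N + 1) fun j hj => hN j (by omega)]
  simp only [annihilation_tmul, annihilationFock_zero_apply, map_smul, if_true, zero_add,
    TensorProduct.zero_tmul, Finsupp.smul_apply, smul_smul, Nat.succ_ne_zero, if_false, zero_smul,
    smul_zero, add_zero, TensorProduct.smul_tmul', TensorProduct.add_tmul, smul_eq_mul]
  rw [← TensorProduct.sum_tmul, TensorProduct.smul_tmul']

variable [Module.Free ℤ L] [Module.Finite ℤ L]

variable (Λ) in
theorem sum_cform_smul_orthonormalBasis (h : Cartan L) :
    ∑ i, cform Λ (orthonormalBasis Λ i) h • orthonormalBasis Λ i = h := by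
  have hcoeff (i) : cform Λ (orthonormalBasis Λ i) h = (orthonormalBasis Λ).repr h i := by
    conv_lhs => rw [← (orthonormalBasis Λ).sum_repr h]
    simp only [map_sum, map_smul, smul_eq_mul, orthonormalBasis,
      (exists_orthonormalBasis Λ).choose_spec, mul_ite, mul_one, mul_zero, Finset.sum_ite_eq,
      Finset.mem_univ, if_true]
  simp only [hcoeff, (orthonormalBasis Λ).sum_repr]

variable (Λ) in
theorem sum_creationSum_annihilationFock (P : Fock L) :
    ∑ i, creationSum (orthonormalBasis Λ i) (annihilationFock Λ (orthonormalBasis Λ i) P) =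
      Fock.degree P := by
  induction P using Fock.induction_creation with
  | algebraMap r =>
    simp only [annihilationFock_algebraMap, map_zero, Finset.sum_const_zero,
      Derivation.map_algebraMap]
  | creation n h =>
    rw [Fock.degree_creation]
    conv_rhs => rw [← sum_cform_smul_orthonormalBasis Λ h, map_sum, Finset.smul_sum]
    refine Finset.sum_congr rfl fun i _ => ?_
    rw [annihilationFock_creation, creationSum, Finsupp.linearCombination_single,
      algebraMap_smul, Nat.add_sub_cancel, map_smul, smul_smul]
  | mul P Q hP hQ =>
    simp only [annihilationFock_mul, map_add, map_smul, Finset.sum_add_distrib,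
      ← Finset.smul_sum, hP, hQ, Derivation.leibniz]
  | add P Q hP hQ => simp only [map_add, Finset.sum_add_distrib, hP, hQ]

theorem Y_omega : Y E (omega E) = (1 / 2 : ℂ) • ∑ i,
    normalOrder E (Finsupp.single 0 (orthonormalBasis Λ i))
      (heisenberg E (orthonormalBasis Λ i)) := by
  simp only [omega, map_smul, map_sum, Y_tmul, pow_two, map_mul, Module.End.mul_apply,
    normalOrderFock, Fock.lift_creation, vertexIota_one, heisenberg]

theorem ncoeff_omega_tmul (P : Fock L) (a : G) :
    VertexOperator.ncoeff (Y E (omega E)) 1 (P ⊗ₜ tw E a) =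
      (Fock.degree P + ((Λ.form (bar E a) (bar E a) : ℂ) / 2) • P) ⊗ₜ tw E a := by
  have hnorm : ∑ i, cform Λ (orthonormalBasis Λ i) (cbar E a) *
      cform Λ (orthonormalBasis Λ i) (cbar E a) = (Λ.form (bar E a) (bar E a) : ℂ) := by
    simpa only [map_sum, map_smul, LinearMap.sum_apply, LinearMap.smul_apply, smul_eq_mul,
      cform_tmul] using
      congrArg (cform Λ · (cbar E a)) (sum_cform_smul_orthonormalBasis Λ (cbar E a))
  change laurentCoeff (-2) (Y E (omega E) (P ⊗ₜ tw E a)) = _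
  rw [Y_omega, LinearMap.smul_apply, map_smul, LinearMap.sum_apply, map_sum]
  simp only [laurentCoeff_normalOrder_heisenberg_tmul]
  rw [← TensorProduct.sum_tmul, Finset.sum_add_distrib, ← Finset.sum_smul, hnorm,
    ← Finset.smul_sum, sum_creationSum_annihilationFock, TensorProduct.smul_tmul']
  congr 1
  module

theorem ncoeff_omega_translate (u : VL E) :
    VertexOperator.ncoeff (Y E (omega E)) 1 (translate E u) =
      translate E (VertexOperator.ncoeff (Y E (omega E)) 1 u) + translate E u := by
  have key : VertexOperator.ncoeff (Y E (omega E)) 1 ∘ₗ translate E =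
      translate E ∘ₗ VertexOperator.ncoeff (Y E (omega E)) 1 + translate E := by
    refine VL_ext E fun P a => ?_
    have hdeg : Fock.degree (Fock.translation P) =
        Fock.translation (Fock.degree P) + Fock.translation P := by
      rw [← sub_eq_iff_eq_add', ← Derivation.commutator_apply, Fock.lie_degree_translation]
    simp only [LinearMap.comp_apply, LinearMap.add_apply, translate_tmul, ncoeff_omega_tmul,
      ← TensorProduct.add_tmul, map_add, hdeg, Derivation.leibniz, Fock.degree_creation,
      Derivation.map_smul, smul_add, mul_add, mul_smul_comm, smul_eq_mul, mul_comm P]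
    congr 1
    push_cast
    rw [smul_mul_assoc]
    module
  exact LinearMap.congr_fun key u

theorem mem_weightSpace_iff {n : ℤ} {u : VL E} :
    u ∈ weightSpace (Y E) (omega E) n ↔
      VertexOperator.ncoeff (Y E (omega E)) 1 u = (n : ℂ) • u :=
  Module.End.mem_eigenspace_iff

theorem translate_mem_weightSpace {n : ℤ} {u : VL E} (hu : u ∈ weightSpace (Y E) (omega E) n) :
    translate E u ∈ weightSpace (Y E) (omega E) (n + 1) := by
  rw [mem_weightSpace_iff] at hu ⊢
  rw [ncoeff_omega_translate, hu, map_smul, Int.cast_add, Int.cast_one, add_smul, one_smul]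

theorem creation_mem_weightSpace (n : ℕ) (h : Cartan L) :
    creation n h ⊗ₜ tw E 1 ∈ weightSpace (Y E) (omega E) (n + 1) := by
  rw [mem_weightSpace_iff, ncoeff_omega_tmul, bar_one, Fock.degree_creation]
  simp [TensorProduct.smul_tmul']

theorem iota_mem_weightSpace (a : G) (n : ℤ) (hn : Λ.form (bar E a) (bar E a) = 2 * n) :
    iota E a ∈ weightSpace (Y E) (omega E) n := by
  rw [mem_weightSpace_iff, iota, ncoeff_omega_tmul, hn, Derivation.map_one_eq_zero, zero_add,
    TensorProduct.smul_tmul']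
  congr 2
  push_cast
  ring

end Weight

/-! ### The Heisenberg relations -/

section Zhu

variable {L : Type*} [AddCommGroup L] {Λ : EvenLattice L} {G : Type*} [Group G]
  (E : CentralExtension Λ G) (θ : G ≃* G) (hθ : ∀ a, bar E (θ a) = -bar E a)

/-- The automorphism of `M(1)` with `h(-n) ↦ -h(-n)`. -/
def Fock.negate : Fock L →ₐ[ℂ] Fock L := Fock.lift (-Fock.gen) fun _ _ => mul_comm _ _

theorem Fock.negate_creation (n : ℕ) (h : Cartan L) :
    Fock.negate (creation n h) = -creation n h := by
  rw [Fock.negate, Fock.lift_creation, LinearMap.neg_apply, Fock.gen_single]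

theorem Fock.translation_negate (P : Fock L) :
    Fock.translation (Fock.negate P) = Fock.negate (Fock.translation P) := by
  induction P using Fock.induction_creation with
  | algebraMap r => simp only [AlgHom.commutes, Derivation.map_algebraMap, map_zero]
  | creation n h =>
    rw [Fock.negate_creation, map_neg, Fock.translation_creation, map_smul, Fock.negate_creation,
      smul_neg]
  | mul P Q hP hQ => simp only [map_mul, Derivation.leibniz, smul_eq_mul, map_add, hP, hQ]
  | add P Q hP hQ => simp only [map_add, hP, hQ]

theorem thetaMap_tmul (P : Fock L) (a : G) :
    thetaMap E θ hθ (P ⊗ₜ tw E a) = Fock.negate P ⊗ₜ tw E (θ a) := by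
  rw [thetaMap, TensorProduct.map_tmul, twLift_tw]
  rfl

theorem thetaMap_translate (u : VL E) :
    thetaMap E θ hθ (translate E u) = translate E (thetaMap E θ hθ u) := by
  have key : thetaMap E θ hθ ∘ₗ translate E = translate E ∘ₗ thetaMap E θ hθ := by
    refine VL_ext E fun P a => ?_
    simp only [LinearMap.comp_apply, translate_tmul, thetaMap_tmul, map_add, map_mul,
      Fock.translation_negate, Fock.negate_creation, cbar, hθ, TensorProduct.tmul_neg, map_neg]
  exact LinearMap.congr_fun key u

theorem annihilation_smul (h : Cartan L) (P : Fock L) (v : VL E) (i : ℕ) :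
    annihilation E h (P • v) i =
      P • annihilation E h v i + annihilationFock Λ h P i • v := by
  induction v using VL_induction E with
  | tmul Q a =>
    simp only [TensorProduct.smul_tmul', annihilation_tmul, smul_eq_mul, annihilationFock_mul,
      Finsupp.add_apply, Finsupp.smul_apply, smul_add, TensorProduct.add_tmul, mul_comm Q,
      mul_smul_comm]
    abel
  | add v w hv hw =>
    simp only [smul_add, map_add, Finsupp.add_apply, hv, hw]
    abel

theorem residue_Y_iota (s : ℂ) (a b : G) (p q : ℕ)
    (h : (p : ℤ) = Λ.form (bar E a) (bar E b) + q) :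
    residue s (p + 1) (Y E (iota E a) (iota E b)) = ∑ j ∈ Finset.range (q + 1),
      Ring.choose s j • (PowerSeries.coeff (q - j) (expSeries (cbar E a)) ⊗ₜ tw E (a * b)) := by
  have hcoeff (n : ℤ) : laurentCoeff n (Y E (iota E a) (iota E b)) =
      (HahnSeries.ofPowerSeries ℤ (Fock L) (expSeries (cbar E a))).coeff
        (n - Λ.form (bar E a) (bar E b)) • iota E (a * b) := by
    rw [iota, Y_tmul, map_one, Module.End.one_apply, iota, vertexIota_apply,
      laurentCoeff_seriesAction_constSeries, iotaSeries, map_one (annihilationExp E a),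
      mul_one, HahnSeries.coeff_single_mul, one_mul]
  rw [residue_eq_sum _ _ _ (q + 1) fun j hj => by
    rw [hcoeff, PowerSeries.coeff_coe, if_pos (by omega), zero_smul]]
  refine Finset.sum_congr rfl fun j hj => ?_
  have hj : j ≤ q := Finset.mem_range_succ_iff.1 hj
  have hindex : (p : ℤ) + 1 - 1 - j - Λ.form (bar E a) (bar E b) = ((q - j : ℕ) : ℤ) := by omega
  rw [hcoeff, hindex, HahnSeries.ofPowerSeries_apply_coeff, iota, TensorProduct.smul_tmul',
    smul_eq_mul, mul_one]

/-- The largest submodule of `T` which is stable under all the operators `h(i)`, `i ≥ 0`. -/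
def annihilationCore (T : Submodule ℂ (VL E)) : Submodule ℂ (VL E) :=
  sSup {W | W ≤ T ∧ ∀ h i, ∀ v ∈ W, annihilation E h v i ∈ W}

theorem annihilationCore_le (T : Submodule ℂ (VL E)) : annihilationCore E T ≤ T :=
  sSup_le fun _ hW => hW.1

theorem annihilation_mem_annihilationCore {T : Submodule ℂ (VL E)} (h : Cartan L) (i : ℕ)
    {v : VL E} (hv : v ∈ annihilationCore E T) : annihilation E h v i ∈ annihilationCore E T := by
  suffices annihilationCore E T ≤
    (annihilationCore E T).comap (Finsupp.lapply i ∘ₗ annihilation E h) from this hv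
  exact sSup_le fun W hW v hv => (le_sSup hW : W ≤ annihilationCore E T) (hW.2 h i v hv)

theorem iota_mem_annihilationCore {T : Submodule ℂ (VL E)} (hT : ∀ a, iota E a ∈ T) (a : G) :
    iota E a ∈ annihilationCore E T := by
  have hspan : Submodule.span ℂ (Set.range (iota E)) ≤ annihilationCore E T := by
    refine le_sSup ⟨Submodule.span_le.2 (Set.range_subset_iff.2 hT), fun h i => ?_⟩
    suffices Submodule.span ℂ (Set.range (iota E)) ≤ (Submodule.span ℂ (Set.range (iota E))).comap
      (Finsupp.lapply i ∘ₗ annihilation E h) from fun v hv => this hv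
    rw [Submodule.span_le, Set.range_subset_iff]
    intro b
    rw [SetLike.mem_coe, Submodule.mem_comap, LinearMap.comp_apply, Finsupp.lapply_apply, iota,
      annihilation_tmul, ← map_one (algebraMap ℂ (Fock L)), annihilationFock_algebraMap,
      Finsupp.coe_zero, Pi.zero_apply, TensorProduct.zero_tmul, zero_add, map_one]
    exact Submodule.smul_mem _ _ (Submodule.subset_span ⟨b, rfl⟩)
  exact hspan (Submodule.subset_span ⟨a, rfl⟩)

variable [Module.Free ℤ L] [Module.Finite ℤ L]

/-- The space `O_θ(V_L)`. -/
abbrev zhuO : Submodule ℂ (VL E) := O (Y E) (omega E) (thetaMap E θ hθ) 2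

theorem residue_mem_zhuO (p : ℕ) {n : ℤ} {u : VL E} (hu : thetaMap E θ hθ u = -u)
    (hn : u ∈ weightSpace (Y E) (omega E) n) (v : VL E) :
    residue ((n : ℂ) - 1 / 2) (p + 1) (Y E u v) ∈ zhuO E θ hθ :=
  residue_mem_O (isDeriv_Y_translate E) (fun _ _ => translate_mem_weightSpace E)
    (thetaMap_translate E θ hθ) p hu hn v

theorem heisenberg_relation (h : Cartan L) (p : ℕ) (v : VL E) (N : ℕ)
    (hN : ∀ j, N ≤ j → annihilation E h v j = 0) :
    ∑ j ∈ Finset.range (p + 1), Ring.choose (1 / 2 : ℂ) j • creation (p - j) h • v +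
      ∑ i ∈ Finset.range N, Ring.choose (1 / 2 : ℂ) (p + 1 + i) • annihilation E h v i ∈
        zhuO E θ hθ := by
  have hmem := residue_mem_zhuO E θ hθ p (u := creation 0 h ⊗ₜ tw E 1)
    (by rw [thetaMap_tmul, Fock.negate_creation, map_one, TensorProduct.neg_tmul])
    (creation_mem_weightSpace E 0 h) v
  have hexp : (((0 : ℕ) : ℤ) + 1 : ℤ) - (1 / 2 : ℂ) = 1 / 2 := by norm_num
  have hneg (i : ℕ) : ((p : ℤ) + 1 - 1 - (p + 1 + i : ℕ) : ℤ) = -1 - i := by push_cast; ring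
  rw [Y_creation, ← heisenberg, hexp, residue_eq_sum _ _ _ (p + 1 + N) fun j hj => by
      obtain ⟨i, rfl⟩ := Nat.exists_eq_add_of_le (le_of_add_le_left hj)
      rw [hneg, laurentCoeff_heisenberg_neg, hN i (by omega)],
    Finset.sum_range_add] at hmem
  simp only [hneg, laurentCoeff_heisenberg_neg] at hmem
  rwa [Finset.sum_congr rfl fun j hj => by
    have hj : j ≤ p := Finset.mem_range_succ_iff.1 hj
    rw [← laurentCoeff_heisenberg_natCast, Nat.cast_sub hj, ← add_sub_cancel_right (p : ℤ) 1]]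

theorem creation_smul_mem_of_annihilation_mem {T : Submodule ℂ (VL E)} (hT : zhuO E θ hθ ≤ T)
    {h : Cartan L} {v : VL E} (hv : ∀ i, annihilation E h v i ∈ T) (n : ℕ) :
    creation n h • v ∈ T := by
  induction n using Nat.strong_induction_on with
  | _ n ih =>
    obtain ⟨N, hN⟩ := exists_forall_ge_eq_zero (annihilation E h v)
    have hrel := hT (heisenberg_relation E θ hθ h n v N hN)
    rw [Submodule.add_mem_iff_left _ (Submodule.sum_mem _ fun i _ => T.smul_mem _ (hv i)),
      Finset.sum_range_succ', Submodule.add_mem_iff_right _ (Submodule.sum_mem _ fun j hj =>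
        T.smul_mem _ (ih _ (by have := Finset.mem_range.1 hj; omega))),
      Ring.choose_zero_right, one_smul, Nat.sub_zero] at hrel
    exact hrel

theorem creation_smul_mem_annihilationCore {T : Submodule ℂ (VL E)} (hT : zhuO E θ hθ ≤ T)
    (n : ℕ) (h : Cartan L) {v : VL E} (hv : v ∈ annihilationCore E T) :
    creation n h • v ∈ annihilationCore E T := by
  set S : Set (VL E) :=
    {w | ∃ (n : ℕ) (h : Cartan L), ∃ v ∈ annihilationCore E T, creation n h • v = w}
  set W : Submodule ℂ (VL E) := annihilationCore E T ⊔ Submodule.span ℂ S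
  have hWT : W ≤ T := by
    refine sup_le (annihilationCore_le E T) (Submodule.span_le.2 ?_)
    rintro _ ⟨n, h, v, hv, rfl⟩
    exact creation_smul_mem_of_annihilation_mem E θ hθ hT
      (fun i => annihilationCore_le E T (annihilation_mem_annihilationCore E h i hv)) n
  have hstable (k i) : W ≤ W.comap (Finsupp.lapply i ∘ₗ annihilation E k) := by
    refine sup_le (fun v hv => Submodule.mem_sup_left
      (annihilation_mem_annihilationCore E k i hv)) (Submodule.span_le.2 ?_)
    rintro _ ⟨n, h, v, hv, rfl⟩
    rw [SetLike.mem_coe, Submodule.mem_comap, LinearMap.comp_apply, Finsupp.lapply_apply,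
      annihilation_smul, annihilationFock_creation, Finsupp.single_apply]
    refine add_mem (Submodule.mem_sup_right (Submodule.subset_span
      ⟨n, h, _, annihilation_mem_annihilationCore E k i hv, rfl⟩)) (Submodule.mem_sup_left ?_)
    split_ifs
    · rw [algebraMap_smul]
      exact Submodule.smul_mem _ _ hv
    · rw [zero_smul]
      exact zero_mem _
  exact (le_sSup ⟨hWT, fun k i v hv => hstable k i hv⟩ : W ≤ annihilationCore E T)
    (Submodule.mem_sup_right (Submodule.subset_span ⟨n, h, v, hv, rfl⟩))

theorem zhuO_sup_span_iota : zhuO E θ hθ ⊔ Submodule.span ℂ (Set.range (iota E)) = ⊤ := by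
  set T := zhuO E θ hθ ⊔ Submodule.span ℂ (Set.range (iota E))
  have smul_mem (P : Fock L) : ∀ v ∈ annihilationCore E T, P • v ∈ annihilationCore E T := by
    induction P using Fock.induction_creation with
    | algebraMap r => intro v hv; rw [algebraMap_smul]; exact Submodule.smul_mem _ _ hv
    | creation n h =>
      exact fun v hv => creation_smul_mem_annihilationCore E θ hθ le_sup_left n h hv
    | mul P Q hP hQ => intro v hv; rw [mul_smul]; exact hP _ (hQ v hv)
    | add P Q hP hQ => intro v hv; rw [add_smul]; exact add_mem (hP v hv) (hQ v hv)
  refine eq_top_iff.2 fun v _ => annihilationCore_le E T ?_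
  induction v using VL_induction E with
  | tmul P a =>
    have hiota := iota_mem_annihilationCore E
      (fun b => (Submodule.mem_sup_right (Submodule.subset_span ⟨b, rfl⟩) : iota E b ∈ T)) a
    simpa only [iota, TensorProduct.smul_tmul', smul_eq_mul, mul_one] using smul_mem P _ hiota
  | add v w hv hw => exact add_mem (hv trivial) (hw trivial)

end Zhu

end LatticeVOA

namespace TwistedZhu

/-! ### A linear differential equation -/

section SquareRoot

open PowerSeries

theorem mul_derivative_mul {R : Type*} [CommRing R] {s p q f g : R⟦X⟧}
    (hf : s * derivative R f = p * f) (hg : s * derivative R g = q * g) :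
    s * derivative R (f * g) = (p + q) * (f * g) := by
  rw [Derivation.leibniz, smul_eq_mul, smul_eq_mul]
  linear_combination g * hf + f * hg

theorem mul_derivative_pow {R : Type*} [CommRing R] {s p f : R⟦X⟧}
    (hf : s * derivative R f = p * f) (k : ℕ) :
    s * derivative R (f ^ k) = (k * p) * f ^ k := by
  induction k with
  | zero => rw [pow_zero, derivative_one, Nat.cast_zero, zero_mul, zero_mul, mul_zero]
  | succ k ih =>
    rw [pow_succ, mul_derivative_mul ih hf]
    push_cast
    ring

/-- The power series `(1 + z)^(1/2)`. -/
def sqrtSeries : ℂ⟦X⟧ := PowerSeries.binomialSeries ℂ (1 / 2 : ℂ)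

/-- The power series `(1 + z)^(-1/2)`. -/
def invSqrtSeries : ℂ⟦X⟧ := PowerSeries.binomialSeries ℂ (-1 / 2 : ℂ)

/-- The power series `((1 + z)^(1/2) - 1) / z`. -/
def sqrtQuotient : ℂ⟦X⟧ := mk fun p => Ring.choose (1 / 2 : ℂ) (p + 1)

/-- The power series `(1 + (1 + z)^(1/2)) / 2`. -/
def sqrtMean : ℂ⟦X⟧ := C (1 / 2 : ℂ) * (1 + sqrtSeries)

theorem sqrtSeries_mul_self : sqrtSeries * sqrtSeries = 1 + X := by
  have hone : (1 / 2 : ℂ) + 1 / 2 = (1 : ℕ) := by norm_num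
  rw [sqrtSeries, ← binomialSeries_add, hone, binomialSeries_nat, pow_one]

theorem sqrtSeries_mul_invSqrtSeries : sqrtSeries * invSqrtSeries = 1 := by
  have hzero : (1 / 2 : ℂ) + -1 / 2 = 0 := by norm_num
  rw [sqrtSeries, invSqrtSeries, ← binomialSeries_add, hzero, binomialSeries_zero]

theorem isUnit_sqrtSeries : IsUnit sqrtSeries := .of_mul_eq_one _ sqrtSeries_mul_invSqrtSeries

theorem derivative_sqrtSeries : derivative ℂ sqrtSeries = C (1 / 2 : ℂ) * invSqrtSeries := by
  have hhalf : (1 / 2 : ℂ) = -1 / 2 + 1 := by norm_num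
  rw [sqrtSeries, hhalf, derivative_binomialSeries, ← smul_eq_C_mul, invSqrtSeries]

theorem X_mul_sqrtQuotient : X * sqrtQuotient = sqrtSeries - 1 := by
  ext n
  cases n with
  | zero => simp [sqrtSeries]
  | succ n => simp [coeff_succ_X_mul, sqrtQuotient, sqrtSeries, coeff_one]

theorem sqrtQuotient_mul_one_add_sqrtSeries : sqrtQuotient * (1 + sqrtSeries) = 1 := by
  refine mul_left_cancel₀ (X_ne_zero : (X : ℂ⟦X⟧) ≠ 0) ?_
  rw [← mul_assoc, X_mul_sqrtQuotient, mul_one]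
  linear_combination sqrtSeries_mul_self

theorem sqrtSeries_mul_derivative_sqrtMean :
    sqrtSeries * derivative ℂ sqrtMean = (C (1 / 2 : ℂ) * sqrtQuotient) * sqrtMean := by
  rw [sqrtMean, Derivation.leibniz, derivative_C, map_add, derivative_one, derivative_sqrtSeries,
    smul_zero, add_zero, zero_add, smul_eq_mul]
  linear_combination C (1 / 2 : ℂ) * C (1 / 2 : ℂ) *
    (sqrtSeries_mul_invSqrtSeries - sqrtQuotient_mul_one_add_sqrtSeries)

theorem sqrtSeries_mul_derivative_binomialSeries (r : ℂ) :
    sqrtSeries * derivative ℂ (PowerSeries.binomialSeries ℂ r) =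
      (C r * invSqrtSeries) * PowerSeries.binomialSeries ℂ r := by
  have hhalf : (1 / 2 : ℂ) + (r - 1) = -1 / 2 + r := by ring
  conv_lhs => rw [← sub_add_cancel r 1, derivative_binomialSeries, sub_add_cancel]
  rw [smul_eq_C_mul, mul_left_comm, sqrtSeries, ← binomialSeries_add, hhalf, binomialSeries_add,
    invSqrtSeries, mul_assoc]

theorem constantCoeff_sqrtMean : constantCoeff sqrtMean = 1 := by
  rw [sqrtMean, map_mul, map_add, map_one, constantCoeff_C, sqrtSeries,
    binomialSeries_constantCoeff]
  norm_num

theorem eq_binomialSeries_mul_sqrtMean_pow (m n : ℕ) {f : ℂ⟦X⟧}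
    (hf : sqrtSeries * derivative ℂ f =
      (C (m : ℂ) * sqrtQuotient - C (2 * n : ℂ) * derivative ℂ sqrtSeries) * f) :
    f = C (constantCoeff f) *
      (PowerSeries.binomialSeries ℂ (-n : ℂ) * sqrtMean ^ (2 * m)) := by
  refine eq_C_mul_of_mul_derivative_eq isUnit_sqrtSeries hf ?_ ?_
  · have hhalf : (2 : ℂ⟦X⟧) * C (1 / 2 : ℂ) = 1 := by
      rw [← map_ofNat C 2, ← map_mul]
      norm_num
    rw [mul_derivative_mul (sqrtSeries_mul_derivative_binomialSeries _)
      (mul_derivative_pow sqrtSeries_mul_derivative_sqrtMean _), derivative_sqrtSeries]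
    simp only [map_neg, map_mul, map_natCast, map_ofNat, Nat.cast_mul, Nat.cast_ofNat]
    linear_combination (m * sqrtQuotient + n * invSqrtSeries) *
      (PowerSeries.binomialSeries ℂ (-n : ℂ) * sqrtMean ^ (2 * m)) * hhalf
  · rw [map_mul, map_pow, constantCoeff_sqrtMean, one_pow, mul_one, binomialSeries_constantCoeff]

theorem coeff_invSqrtSeries_mul_pow_sub_pow {k n : ℕ} (h : k ≤ 2 * n) :
    coeff n (invSqrtSeries * ((1 + sqrtSeries) ^ k - (1 - sqrtSeries) ^ k)) = 0 := by
  induction k using Nat.strong_induction_on generalizing n with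
  | _ k ih =>
    match k with
    | 0 => rw [pow_zero, pow_zero, sub_self, mul_zero, map_zero]
    | 1 =>
      have htwo : invSqrtSeries * ((1 + sqrtSeries) ^ 1 - (1 - sqrtSeries) ^ 1) = C (2 : ℂ) := by
        rw [map_ofNat]
        linear_combination 2 * sqrtSeries_mul_invSqrtSeries
      rw [htwo, coeff_C, if_neg (by omega)]
    | k + 2 =>
      obtain ⟨n, rfl⟩ : ∃ n', n = n' + 1 := ⟨n - 1, by omega⟩
      -- `1 ± (1 + z)^(1/2)` are the roots of `x^2 = 2 x + z`
      have hrec : invSqrtSeries * ((1 + sqrtSeries) ^ (k + 2) - (1 - sqrtSeries) ^ (k + 2)) =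
          C (2 : ℂ) * (invSqrtSeries * ((1 + sqrtSeries) ^ (k + 1) - (1 - sqrtSeries) ^ (k + 1))) +
          X * (invSqrtSeries * ((1 + sqrtSeries) ^ k - (1 - sqrtSeries) ^ k)) := by
        rw [map_ofNat]
        linear_combination invSqrtSeries * ((1 + sqrtSeries) ^ k - (1 - sqrtSeries) ^ k) *
          sqrtSeries_mul_self
      rw [hrec, map_add, coeff_C_mul, coeff_succ_X_mul, ih (k + 1) (by omega) (by omega),
        ih k (by omega) (by omega), mul_zero, add_zero]

theorem coeff_invSqrtSeries_mul_sqrtMean_pow (m : ℕ) :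
    coeff (2 * m) (invSqrtSeries * sqrtMean ^ (2 * m)) = (1 / 16) ^ m := by
  have hconj : (1 - sqrtSeries) ^ (2 * m) = X ^ (2 * m) * sqrtQuotient ^ (2 * m) := by
    rw [← mul_pow, X_mul_sqrtQuotient, ← neg_sub, (even_two_mul m).neg_pow]
  have hquot : constantCoeff sqrtQuotient = 1 / 2 := by
    rw [← coeff_zero_eq_constantCoeff_apply, sqrtQuotient, coeff_mk, zero_add,
      Ring.choose_one_right]
  have hsub := coeff_invSqrtSeries_mul_pow_sub_pow (k := 2 * m) (n := 2 * m) (by omega)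
  rw [mul_sub, map_sub, sub_eq_zero, hconj, mul_left_comm, coeff_X_pow_mul', if_pos le_rfl,
    Nat.sub_self, coeff_zero_eq_constantCoeff_apply, map_mul constantCoeff, map_pow constantCoeff,
    hquot, invSqrtSeries, binomialSeries_constantCoeff, one_mul, ← invSqrtSeries] at hsub
  rw [sqrtMean, mul_pow, mul_left_comm, ← map_pow, coeff_C_mul, hsub, ← mul_pow, pow_mul]
  norm_num

theorem coeff_binomialSeries_mul_eq (m n : ℕ) {f : ℂ⟦X⟧}
    (hf : sqrtSeries * derivative ℂ f =
      (C (m : ℂ) * sqrtQuotient - C (2 * n : ℂ) * derivative ℂ sqrtSeries) * f) :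
    coeff (2 * m) (PowerSeries.binomialSeries ℂ (n - 1 / 2 : ℂ) * f) =
      (1 / 16) ^ m * constantCoeff f := by
  have hexp : (n - 1 / 2 : ℂ) + -n = -1 / 2 := by ring
  rw [eq_binomialSeries_mul_sqrtMean_pow m n hf, mul_left_comm,
    ← mul_assoc (PowerSeries.binomialSeries _ _), ← binomialSeries_add, hexp, ← invSqrtSeries,
    coeff_C_mul, coeff_invSqrtSeries_mul_sqrtMean_pow, mul_comm]
  simp [constantCoeff_sqrtMean]

end SquareRoot

end TwistedZhu

theorem finite_quotient_range_zsmulAddGroupHom_two (A : Type*) [AddCommGroup A]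
    [Module.Finite ℤ A] : Finite (A ⧸ (zsmulAddGroupHom (2 : ℤ) : A →+ A).range) := by
  have hrange : (zsmulAddGroupHom (2 : ℤ) : A →+ A).range = (nsmulAddMonoidHom 2).range := by
    ext x
    simp only [AddMonoidHom.mem_range, zsmulAddGroupHom_apply, nsmulAddMonoidHom_apply, two_smul]
  have : AddGroup.FG A := Module.Finite.iff_addGroup_fg.1 inferInstance
  have := AddSubgroup.finiteIndex_range_nsmulAddMonoidHom_of_fg A two_ne_zero
  rw [hrange]
  infer_instance

theorem rank_le_natCard_of_span_range_eq_top {R M ι : Type*} [Ring R] [StrongRankCondition R]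
    [AddCommGroup M] [Module R M] [Finite ι] {v : ι → M}
    (hv : Submodule.span R (Set.range v) = ⊤) : Module.rank R M ≤ Nat.card ι := by
  rw [← rank_top, ← hv]
  refine (rank_span_le _).trans ?_
  rw [← Nat.cast_card]
  exact_mod_cast Finite.card_range_le v

namespace TwistedZhu

section Antidiagonal

open PowerSeries Finset.HasAntidiagonal

theorem sum_antidiagonal_assoc {M : Type*} [AddCommMonoid M] (n : ℕ) (f : ℕ → ℕ → ℕ → M) :
    ∑ x ∈ antidiagonal n, ∑ y ∈ antidiagonal x.2, f x.1 y.1 y.2 =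
      ∑ x ∈ antidiagonal n, ∑ y ∈ antidiagonal x.1, f y.1 y.2 x.2 := by
  rw [Finset.sum_sigma', Finset.sum_sigma']
  refine Finset.sum_bij' (fun x _ => ⟨(x.1.1 + x.2.1, x.2.2), (x.1.1, x.2.1)⟩)
    (fun x _ => ⟨(x.2.1, x.2.2 + x.1.2), (x.2.2, x.1.2)⟩) ?_ ?_ ?_ ?_ ?_
  all_goals
    rintro ⟨⟨a, b⟩, ⟨c, d⟩⟩ h
    simp only [Finset.mem_sigma, mem_antidiagonal] at h ⊢
  · exact ⟨by omega, trivial⟩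
  · exact ⟨by omega, trivial⟩
  · rw [h.2]
  · rw [h.2]

variable {R : Type*} [CommRing R]

theorem coeff_derivative_mul (f g : R⟦X⟧) (q : ℕ) :
    coeff q (derivative R f * g) = ∑ x ∈ antidiagonal q, ∑ y ∈ antidiagonal x.2,
      coeff (x.1 + y.1 + 1) f * coeff y.2 g := by
  rw [sum_antidiagonal_assoc q (fun p i k => coeff (p + i + 1) f * coeff k g), coeff_mul]
  refine Finset.sum_congr rfl fun x _ => ?_
  rw [Finset.sum_congr rfl (g := fun _ => coeff (x.1 + 1) f * coeff x.2 g)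
    (fun y hy => by rw [mem_antidiagonal.1 hy]), Finset.sum_const, Finset.Nat.card_antidiagonal,
    coeff_derivative, nsmul_eq_mul, Nat.cast_add_one]
  ring

theorem mul_eq_of_forall_sum_antidiagonal {s t f g : R⟦X⟧} {α β : R} (u : ℕ → ℕ → R)
    (hf : ∀ r, coeff r f = ∑ y ∈ antidiagonal r, u y.1 y.2)
    (hu : ∀ p k, ∑ y ∈ antidiagonal p, coeff y.1 s * u y.2 k +
      (α * (coeff p t * coeff k g) +
        β * ∑ y ∈ antidiagonal k, coeff (p + y.1 + 1) s * coeff y.2 g) = 0) :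
    s * f = -(C α * t + C β * derivative R s) * g := by
  rw [eq_comm, neg_mul, neg_eq_iff_add_eq_zero, add_comm]
  ext q
  rw [map_add, add_mul, map_add, mul_assoc, mul_assoc, coeff_C_mul, coeff_C_mul,
    coeff_derivative_mul, coeff_mul, coeff_mul]
  simp only [hf, Finset.mul_sum]
  rw [sum_antidiagonal_assoc q fun j n k => coeff j s * u n k, ← Finset.sum_add_distrib,
    ← Finset.sum_add_distrib, map_zero]
  refine Finset.sum_eq_zero fun x _ => ?_
  simpa only [Finset.mul_sum] using hu x.1 x.2

end Antidiagonal

end TwistedZhu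

namespace LatticeVOA

open TwistedZhu

/-! ### The relations between the vectors `ι(a)` -/

section Relations

open PowerSeries Finset.HasAntidiagonal

variable {L : Type*} [AddCommGroup L] {Λ : EvenLattice L} {G : Type*} [Group G]
  (E : CentralExtension Λ G)

/-- The series `∑_k ℓ(S_k ⊗ ι(c)) z^k`, where `∑_k S_k z^k = exp(∑_{n > 0} ā(-n) z^n / n)`. -/
def pairingSeries (ℓ : VL E →ₗ[ℂ] ℂ) (a c : G) : ℂ⟦X⟧ :=
  mapCoeff (ℓ ∘ₗ (TensorProduct.mk ℂ _ _).flip (tw E c)) (expSeries (cbar E a))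

theorem coeff_pairingSeries (ℓ : VL E →ₗ[ℂ] ℂ) (a c : G) (k : ℕ) :
    coeff k (pairingSeries E ℓ a c) = ℓ (coeff k (expSeries (cbar E a)) ⊗ₜ tw E c) :=
  coeff_mapCoeff _ _ _

theorem coeff_derivative_pairingSeries (ℓ : VL E →ₗ[ℂ] ℂ) (a c : G) (r : ℕ) :
    coeff r (derivative ℂ (pairingSeries E ℓ a c)) = ∑ y ∈ antidiagonal r,
      ℓ (creation y.1 (cbar E a) • (coeff y.2 (expSeries (cbar E a)) ⊗ₜ[ℂ] tw E c)) := by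
  rw [pairingSeries, derivative_mapCoeff, derivative_expSeries, coeff_mapCoeff, coeff_mul, map_sum]
  simp only [creationPart, coeff_mk]
  rfl

theorem annihilationFock_coeff_expSeries (α h : Cartan L) (k i : ℕ) :
    annihilationFock Λ α (coeff k (expSeries h)) (i + 1) =
      if i + 1 ≤ k then cform Λ α h • coeff (k - (i + 1)) (expSeries h) else 0 := by
  rw [← annihilationDerivation_apply, ← Derivation.coeFn_coe, ← coeff_mapCoeff,
    annihilationDerivation_expSeries, mul_assoc, coeff_C_mul, coeff_X_pow_mul', mul_ite, mul_zero,
    Algebra.smul_def]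

theorem annihilation_coeff_expSeries (a b : G) (k i : ℕ) :
    annihilation E (cbar E a) (coeff k (expSeries (cbar E a)) ⊗ₜ tw E (a * b)) i =
      (if i ≤ k then (Λ.form (bar E a) (bar E a) : ℂ) •
        (coeff (k - i) (expSeries (cbar E a)) ⊗ₜ[ℂ] tw E (a * b)) else 0) +
      (if i = 0 then (Λ.form (bar E a) (bar E b) : ℂ) •
        (coeff k (expSeries (cbar E a)) ⊗ₜ[ℂ] tw E (a * b)) else 0) := by
  rw [annihilation_tmul]
  cases i with
  | zero =>
    rw [annihilationFock_zero_apply, cform_tmul, bar_mul, map_add, if_pos k.zero_le, if_pos rfl,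
      if_pos rfl, TensorProduct.zero_tmul, zero_add, Int.cast_add, add_smul, Nat.sub_zero]
  | succ i =>
    rw [annihilationFock_coeff_expSeries, cbar, cform_tmul, if_neg i.succ_ne_zero,
      if_neg i.succ_ne_zero, zero_smul]
    split_ifs
    · rw [TensorProduct.smul_tmul']
    · rw [TensorProduct.zero_tmul]

variable (θ : G ≃* G) (hθ : ∀ a, bar E (θ a) = -bar E a)

theorem exists_form_self_eq (a : G) : ∃ n : ℕ, Λ.form (bar E a) (bar E a) = 2 * n := by
  obtain ⟨r, hr⟩ := Λ.even (bar E a)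
  have hnonneg : 0 ≤ Λ.form (bar E a) (bar E a) := by
    rcases eq_or_ne (bar E a) 0 with h | h
    · rw [h, map_zero]
    · exact (Λ.pos _ h).le
  exact ⟨r.toNat, by omega⟩

theorem iota_eq_or_eq_neg {a b : G} (h : bar E a = bar E b) :
    iota E a = iota E b ∨ iota E a = -iota E b := by
  have hker : E.proj (a * b⁻¹) = 1 := by
    rw [map_mul, map_inv, show E.proj a = E.proj b from h, mul_inv_cancel]
  rcases (E.ker _).1 hker with hab | hab
  · exact .inl (by rw [mul_inv_eq_one.1 hab])
  · exact .inr (by rw [mul_inv_eq_iff_eq_mul.1 hab, iota, tw_neg, TensorProduct.tmul_neg, iota])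

theorem constantCoeff_pairingSeries (ℓ : VL E →ₗ[ℂ] ℂ) (a c : G) :
    constantCoeff (pairingSeries E ℓ a c) = ℓ (iota E c) := by
  rw [← coeff_zero_eq_constantCoeff_apply, coeff_pairingSeries, coeff_zero_eq_constantCoeff_apply,
    constantCoeff_expSeries, iota]

theorem apply_residue_Y_iota (ℓ : VL E →ₗ[ℂ] ℂ) (s : ℂ) (a b : G) (p q : ℕ)
    (h : (p : ℤ) = Λ.form (bar E a) (bar E b) + q) :
    ℓ (residue s (p + 1) (Y E (iota E a) (iota E b))) =
      coeff q (PowerSeries.binomialSeries ℂ s * pairingSeries E ℓ a (a * b)) := by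
  rw [residue_Y_iota E s a b p q h, map_sum, coeff_mul,
    Finset.Nat.sum_antidiagonal_eq_sum_range_succ fun i j =>
      coeff i (PowerSeries.binomialSeries ℂ s) * coeff j (pairingSeries E ℓ a (a * b))]
  simp only [map_smul, binomialSeries_coeff, coeff_pairingSeries, smul_eq_mul, mul_one]

variable [Module.Free ℤ L] [Module.Finite ℤ L]

theorem heisenberg_relation_pairingSeries {ℓ : VL E →ₗ[ℂ] ℂ} (hℓ : zhuO E θ hθ ≤ LinearMap.ker ℓ)
    (a b : G) (p k : ℕ) :
    ∑ y ∈ antidiagonal p, coeff y.1 sqrtSeries *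
        ℓ (creation y.2 (cbar E a) • (coeff k (expSeries (cbar E a)) ⊗ₜ[ℂ] tw E (a * b))) +
      ((Λ.form (bar E a) (bar E b) : ℂ) *
          (coeff p sqrtQuotient * coeff k (pairingSeries E ℓ a (a * b))) +
        (Λ.form (bar E a) (bar E a) : ℂ) * ∑ y ∈ antidiagonal k,
          coeff (p + y.1 + 1) sqrtSeries * coeff y.2 (pairingSeries E ℓ a (a * b))) = 0 := by
  have hrel := hℓ (heisenberg_relation E θ hθ (cbar E a) p
    (coeff k (expSeries (cbar E a)) ⊗ₜ tw E (a * b)) (k + 1) fun j hj => by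
      rw [annihilation_coeff_expSeries, if_neg (by omega), if_neg (by omega), add_zero])
  rw [LinearMap.mem_ker, map_add, map_sum, map_sum] at hrel
  rw [← hrel, Finset.Nat.sum_antidiagonal_eq_sum_range_succ fun i j => coeff i sqrtSeries *
    ℓ (creation j (cbar E a) • (coeff k (expSeries (cbar E a)) ⊗ₜ[ℂ] tw E (a * b))),
    Finset.Nat.sum_antidiagonal_eq_sum_range_succ fun i j =>
      coeff (p + i + 1) sqrtSeries * coeff j (pairingSeries E ℓ a (a * b))]
  simp only [sqrtSeries, sqrtQuotient, coeff_mk, binomialSeries_coeff, coeff_pairingSeries,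
    annihilation_coeff_expSeries, map_smul, smul_add, map_add, Finset.sum_add_distrib, smul_eq_mul,
    mul_one]
  congr 1
  rw [add_comm, Finset.mul_sum]
  congr 1
  · refine Finset.sum_congr rfl fun i hi => ?_
    rw [if_pos (Finset.mem_range_succ_iff.1 hi), map_smul, smul_eq_mul, add_right_comm]
    ring
  · rw [Finset.sum_eq_single_of_mem 0 (Finset.mem_range.2 k.succ_pos) fun i _ hi => by
      rw [if_neg hi, map_zero, mul_zero], if_pos rfl, map_smul, smul_eq_mul, add_zero]
    ring

theorem sqrtSeries_mul_derivative_pairingSeries {ℓ : VL E →ₗ[ℂ] ℂ}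
    (hℓ : zhuO E θ hθ ≤ LinearMap.ker ℓ) (a b : G) :
    sqrtSeries * derivative ℂ (pairingSeries E ℓ a (a * b)) =
      -(C (Λ.form (bar E a) (bar E b) : ℂ) * sqrtQuotient +
        C (Λ.form (bar E a) (bar E a) : ℂ) * derivative ℂ sqrtSeries) *
          pairingSeries E ℓ a (a * b) :=
  mul_eq_of_forall_sum_antidiagonal
    (fun n k => ℓ (creation n (cbar E a) • (coeff k (expSeries (cbar E a)) ⊗ₜ tw E (a * b))))
    (coeff_derivative_pairingSeries E ℓ a (a * b))
    (heisenberg_relation_pairingSeries E θ hθ hℓ a b)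

theorem apply_iota_eq_of_le_ker (hθ2 : ∀ a, θ (θ a) = a) {ℓ : VL E →ₗ[ℂ] ℂ}
    (hℓ : zhuO E θ hθ ≤ LinearMap.ker ℓ) {a b : G} {m : ℕ}
    (hm : Λ.form (bar E a) (bar E b) = m) :
    ℓ (iota E (a * b)) = (1 / 16) ^ m * ℓ (iota E (θ a * b)) := by
  obtain ⟨n, hn⟩ := exists_form_self_eq E a
  have hθn : Λ.form (bar E (θ a)) (bar E (θ a)) = 2 * n := by simp [hθ, hn]
  have hθm : Λ.form (bar E (θ a)) (bar E b) = -m := by simp [hθ, hm]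
  have hmem := hℓ (residue_mem_zhuO E θ hθ m (n := n) (u := iota E a - iota E (θ a))
    (by simp [iota, thetaMap_tmul, hθ2])
    (Submodule.sub_mem _ (iota_mem_weightSpace E a n hn) (iota_mem_weightSpace E (θ a) n hθn))
    (iota E b))
  rw [LinearMap.mem_ker, map_sub, LinearMap.sub_apply, residue_sub, map_sub, sub_eq_zero,
    apply_residue_Y_iota E ℓ _ a b m 0 (by rw [hm, Nat.cast_zero, add_zero]),
    apply_residue_Y_iota E ℓ _ (θ a) b m (2 * m) (by rw [hθm]; push_cast; ring),
    Int.cast_natCast, coeff_zero_eq_constantCoeff_apply, map_mul,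
    binomialSeries_constantCoeff, one_mul, constantCoeff_pairingSeries] at hmem
  rw [hmem, coeff_binomialSeries_mul_eq m n, constantCoeff_pairingSeries]
  rw [sqrtSeries_mul_derivative_pairingSeries E θ hθ hℓ, hθm, hθn]
  simp only [Int.cast_neg, Int.cast_mul, Int.cast_natCast, Int.cast_ofNat, map_neg, map_mul]
  ring

theorem iota_sub_smul_iota_mem_zhuO (hθ2 : ∀ a, θ (θ a) = a) {a b : G} {m : ℕ}
    (hm : Λ.form (bar E a) (bar E b) = m) :
    iota E (a * b) - (1 / 16 : ℂ) ^ m • iota E (θ a * b) ∈ zhuO E θ hθ := by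
  by_contra hmem
  obtain ⟨ℓ, hne, hℓ⟩ := Submodule.exists_le_ker_of_notMem hmem
  exact hne (by rw [map_sub, map_smul, apply_iota_eq_of_le_ker E θ hθ hθ2 hℓ hm, smul_eq_mul,
    sub_self])

theorem mkQ_iota_mul_mem_span (hθ2 : ∀ a, θ (θ a) = a) (a b : G) :
    (zhuO E θ hθ).mkQ (iota E (a * b)) ∈
      Submodule.span ℂ {(zhuO E θ hθ).mkQ (iota E (θ a * b))} := by
  rw [Submodule.mem_span_singleton]
  rcases le_total 0 (Λ.form (bar E a) (bar E b)) with h | h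
  · obtain ⟨m, hm⟩ := Int.eq_ofNat_of_zero_le h
    refine ⟨(1 / 16 : ℂ) ^ m, ?_⟩
    rw [eq_comm, ← map_smul, ← sub_eq_zero, ← map_sub, Submodule.mkQ_apply,
      Submodule.Quotient.mk_eq_zero]
    exact iota_sub_smul_iota_mem_zhuO E θ hθ hθ2 hm
  · obtain ⟨m, hm⟩ := Int.eq_ofNat_of_zero_le (neg_nonneg.2 h)
    refine ⟨((1 / 16 : ℂ) ^ m)⁻¹, ?_⟩
    rw [inv_smul_eq_iff₀ (pow_ne_zero _ (by norm_num)), ← map_smul, ← sub_eq_zero, ← map_sub,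
      Submodule.mkQ_apply, Submodule.Quotient.mk_eq_zero]
    have hmem := iota_sub_smul_iota_mem_zhuO E θ hθ hθ2 (a := θ a) (b := b) (m := m)
      (by simp [hθ, hm])
    rwa [hθ2] at hmem

theorem mkQ_iota_mem_span (hθ2 : ∀ a, θ (θ a) = a) {a c : G}
    (h : bar E a - bar E c ∈ (zsmulAddGroupHom (2 : ℤ) : L →+ L).range) :
    (zhuO E θ hθ).mkQ (iota E a) ∈ Submodule.span ℂ {(zhuO E θ hθ).mkQ (iota E c)} := by
  obtain ⟨γ, hγ⟩ := h
  obtain ⟨g, hg⟩ : ∃ g, bar E g = γ := E.surj (.ofAdd γ)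
  have hbar : bar E (θ g * (g⁻¹ * a)) = bar E c := by
    rw [bar_mul, bar_mul, bar_inv, hθ, hg, sub_eq_iff_eq_add.1 hγ.symm, zsmulAddGroupHom_apply,
      two_smul]
    abel
  have hmem := mkQ_iota_mul_mem_span E θ hθ hθ2 g (g⁻¹ * a)
  rw [mul_inv_cancel_left] at hmem
  rcases iota_eq_or_eq_neg E hbar with hc | hc
  · rwa [hc] at hmem
  · rwa [hc, map_neg, ← Set.neg_singleton, Submodule.span_neg] at hmem

theorem span_range_mkQ_iota (hθ2 : ∀ a, θ (θ a) = a) {I : Type*} {c : I → G}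
    (hc : ∀ a, ∃ i, bar E a - bar E (c i) ∈ (zsmulAddGroupHom (2 : ℤ) : L →+ L).range) :
    Submodule.span ℂ (Set.range fun i => (zhuO E θ hθ).mkQ (iota E (c i))) = ⊤ := by
  rw [← top_le_iff, ← Submodule.range_mkQ (zhuO E θ hθ), LinearMap.range_eq_map,
    ← zhuO_sup_span_iota E θ hθ, Submodule.map_sup, Submodule.mkQ_map_self, bot_sup_eq,
    Submodule.map_span, Submodule.span_le]
  rintro _ ⟨_, ⟨a, rfl⟩, rfl⟩
  obtain ⟨i, hi⟩ := hc a
  exact Submodule.span_mono (Set.singleton_subset_iff.2 (Set.mem_range_self i))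
    (mkQ_iota_mem_span E θ hθ hθ2 hi)

end Relations

end LatticeVOA

end

theorem proposition3p11 {L : Type*} [AddCommGroup L] [Module.Free ℤ L] [Module.Finite ℤ L]
    (Λ : EvenLattice L) {G : Type*} [Group G] (E : CentralExtension Λ G)
    (θ : G ≃* G) (hθ : ∀ a, LatticeVOA.bar E (θ a) = - LatticeVOA.bar E a)
    (hθ2 : ∀ a, θ (θ a) = a)
    (e : L → G) (he : ∀ α, LatticeVOA.bar E (e α) = α)
    (β : L ⧸ (zsmulAddGroupHom (2 : ℤ) : L →+ L).range → L)
    (hβ : ∀ i, QuotientAddGroup.mk (β i) = i) :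
    Submodule.span ℂ (Set.range fun i =>
      (TwistedZhu.O (LatticeVOA.Y E) (LatticeVOA.omega E) (LatticeVOA.thetaMap E θ hθ) 2).mkQ
        (LatticeVOA.iota E (e (β i)))) = ⊤ ∧
    Module.rank ℂ
        (TwistedZhu.A (LatticeVOA.Y E) (LatticeVOA.omega E) (LatticeVOA.thetaMap E θ hθ) 2) ≤
      (Nat.card (L ⧸ (zsmulAddGroupHom (2 : ℤ) : L →+ L).range) : Cardinal) := by
  have hspan := LatticeVOA.span_range_mkQ_iota E θ hθ hθ2 (c := fun i => e (β i)) fun a =>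
    ⟨QuotientAddGroup.mk (LatticeVOA.bar E a), by
      rw [he, ← neg_add_eq_sub, ← QuotientAddGroup.eq, hβ]⟩
  have := finite_quotient_range_zsmulAddGroupHom_two L
  exact ⟨hspan, rank_le_natCard_of_span_range_eq_top hspan⟩
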